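/- All graphs are finite directed graphs (loops and multiple edges allowed) without sources or sinks, an edge $e$ going from $i(e)$ to $t(e)$. A graph is irreducible if there is a path from every vertex to every vertex. $A_G$ is the adjacency matrix, $(A_G)_{vw}=\#\{e : i(e)=v,\ t(e)=w\}$, and $(\Sigma_G,\sigma)$ is the shift of finite type of bi-infinite edge paths, $\sigma(e)^k=e^{k+1}$, regarded as a Smale space with its usual metric and bracket ($[x,y]$ is the future of $x$ glued to the past of $y$). A map of Smale spaces (a continuous map commuting with the dynamics) is s-bijective (u-bijective) if it maps each global stable (unstable) set bijectively onto the stable (unstable) set of the image point. A correspondence $X\xleftarrow{\pi_u}M\xrightarrow{\pi_s}Y$ consists of a Smale space $M$, a u-bijective map $\pi_u$ and an s-bijective map $\pi_s$. Krieger's dimension groups are $$D^s(\Sigma_G,\sigma)=\varinjlim(\mathbb Z^{G^0}\xrightarrow{A_G}\mathbb Z^{G^0}\xrightarrow{A_G}\cdots),\qquad D^u(\Sigma_G,\sigma)=\varinjlim(\mathbb Z^{G^0}\xrightarrow{A_G^t}\mathbb Z^{G^0}\xrightarrow{A_G^t}\cdots),$$ with elements written $[v,j]$. $D^s(\Sigma_G,\sigma)$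 is identified with the abelian group generated by the classes $[E]$ of nonempty compact open subsets $E$ of stable sets, with the relations $[E\cup F]=[E]+[F]$ for disjoint $E,F$ (with $E\cup F$ in one stable set) and $[E]=[F]$ for $E\sim F$. Here $\sim$ is the smallest equivalence relation such that $E\sim F$ if $E,F$ lie in local stable sets, $[E,F]$ and $[F,E]$ are defined, $[E,F]=E$ and $[F,E]=F$, and such that $E\sim F$ if and only if $\sigma(E)\sim\sigma(F)$. The identification sends $[\delta_v,j]$ to the class of $\{y : y^k=x^k \text{ for all } k\ge 1-j\}$, for any path $x$ with $i(x^{1-j})=v$. The group $D^u$ is treated in the same way with $\sigma^{-1}$ in place of $\sigma$; there $[\delta_v,j]$ corresponds to the class of $\{y : y^k=x^k\text{ for all }k\le j\}$, where $t(x^j)=v$. An s-bijective factor map $\pi:\Sigma\to\Sigma'$ induces $\pi^s:D^s(\Sigma)\to D^s(\Sigma')$, $\pi^s[E]=[\pi(E)]$, and a u-bijective factor map $\pi$ induces $\pi^{s*}:D^s(\Sigma')\to D^s(\Sigma)$, $\pi^{s*}[E]=\sum_k[F_k]$, where $\pi^{-1}(E)=\bigcup_kF_k$ is the finite decomposition into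 nonempty compact open subsets of pairwise different stable sets. Exchanging stable and unstable gives $\pi^u$ for u-bijective and $\pi^{u*}$ for s-bijective $\pi$. **Theorem.** Let $G$ and $H$ be irreducible graphs and let $F$ be a nonzero nonnegative integer $H^0\times G^0$ matrix such that $FA_G=A_HF$. Then there are a graph $M$ and a correspondence $$(\Sigma_G,\sigma)\xleftarrow{\ \pi_u\ }(\Sigma_M,\sigma)\xrightarrow{\ \pi_s\ }(\Sigma_H,\sigma),$$ with $\pi_u$ and $\pi_s$ surjective, such that $$\pi_s^s\circ\pi_u^{s*}=F_*:D^s(\Sigma_G,\sigma)\to D^s(\Sigma_H,\sigma),\qquad \pi_u^u\circ\pi_s^{u*}=F^*:D^u(\Sigma_H,\sigma)\to D^u(\Sigma_G,\sigma),$$ where $F_*[v,j]=[Fv,j]$ and $F^*[v,j]=[F^tv,j]$. (The existence of the identifications and of the induced homomorphisms for these graphs and maps is part of the assertion.) -/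

import Mathlib

universe u v

open Topology

/-! ## Smale spaces -/

/-- A Smale space: a compact metric space with a homeomorphism `φ`, expansive constants and a
bracket satisfying the axioms B1-B4, C1, C2.  `bracket x y` is only meaningful when
`dist x y ≤ ε`; each axiom is required whenever all brackets in it are defined. -/
structure SmaleSpace where
  carrier : Type u
  [metric : MetricSpace carrier]
  [compact : CompactSpace carrier]
  φ : carrier ≃ₜ carrier
  ε : ℝ
  ε_pos : 0 < ε
  lam : ℝ
  lam_pos : 0 < lam
  lam_lt_one : lam < 1
  bracket : carrier → carrier → carrier
  bracket_continuous :
    ContinuousOn (fun p : carrier × carrier => bracket p.1 p.2) {p | dist p.1 p.2 ≤ ε}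
  B1 : ∀ x, bracket x x = x
  B2 : ∀ x y z, dist y z ≤ ε → dist x (bracket y z) ≤ ε → dist x z ≤ ε →
    bracket x (bracket y z) = bracket x z
  B3 : ∀ x y z, dist x y ≤ ε → dist (bracket x y) z ≤ ε → dist x z ≤ ε →
    bracket (bracket x y) z = bracket x z
  B4 : ∀ x y, dist x y ≤ ε → dist (φ x) (φ y) ≤ ε →
    φ (bracket x y) = bracket (φ x) (φ y)
  C1 : ∀ x y, dist x y ≤ ε → bracket x y = y → dist (φ x) (φ y) ≤ lam * dist x y
  C2 : ∀ x y, dist x y ≤ ε → bracket x y = x → dist (φ.symm x) (φ.symm y) ≤ lam * dist x y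

attribute [instance] SmaleSpace.metric SmaleSpace.compact

namespace SmaleSpace

instance : CoeSort SmaleSpace.{u} (Type u) := ⟨SmaleSpace.carrier⟩

/-- The inverse Smale space `(X, φ⁻¹)`, with the bracket `(x, y) ↦ [y, x]`.  Its stable sets are
the unstable sets of `X`. -/
abbrev inv (X : SmaleSpace.{u}) : SmaleSpace.{u} where
  carrier := X.carrier
  φ := X.φ.symm
  ε := X.ε
  ε_pos := X.ε_pos
  lam := X.lam
  lam_pos := X.lam_pos
  lam_lt_one := X.lam_lt_one
  bracket := fun x y => X.bracket y x
  bracket_continuous := by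
    refine ContinuousOn.comp (g := fun p : X.carrier × X.carrier => X.bracket p.1 p.2)
      (f := Prod.swap) X.bracket_continuous continuous_swap.continuousOn ?_
    intro p hp
    simpa [dist_comm] using hp
  B1 := X.B1
  B2 := fun x y z h1 h2 h3 =>
    X.B3 z y x (by rwa [dist_comm]) (by rwa [dist_comm]) (by rwa [dist_comm])
  B3 := fun x y z h1 h2 h3 =>
    X.B2 z y x (by rwa [dist_comm]) (by rwa [dist_comm]) (by rwa [dist_comm])
  B4 := by
    intro x y h1 h2
    apply X.φ.injective
    rw [X.B4 (X.φ.symm y) (X.φ.symm x) (by rwa [dist_comm]) (by simpa [dist_comm] using h1)]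
    simp
  C1 := fun x y h1 h2 => by
    simpa [dist_comm] using X.C2 y x (by rwa [dist_comm]) h2
  C2 := fun x y h1 h2 => by
    simpa [dist_comm] using X.C1 y x (by rwa [dist_comm]) h2

/-- The global stable set `X^s(x)`. -/
def stableSet (X : SmaleSpace.{u}) (x : X) : Set X :=
  {y | Filter.Tendsto (fun n : ℕ => dist (X.φ^[n] x) (X.φ^[n] y)) Filter.atTop (nhds 0)}

/-- The global unstable set `X^u(x)`. -/
def unstableSet (X : SmaleSpace.{u}) (x : X) : Set X :=
  {y | Filter.Tendsto (fun n : ℕ => dist (X.φ.symm^[n] x) (X.φ.symm^[n] y))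
    Filter.atTop (nhds 0)}

/-- The local stable set `X^s(x, δ)`. -/
def localStable (X : SmaleSpace.{u}) (x : X) (δ : ℝ) : Set X :=
  {y | dist x y < δ ∧ X.bracket y x = x}

/-- The topology on `X` with base the local stable sets `X^s(x, δ)`, `0 < δ < ε`.  It is the
disjoint union of the usual locally compact topologies of the global stable sets. -/
@[reducible] def stableTopology (X : SmaleSpace.{u}) : TopologicalSpace X :=
  TopologicalSpace.generateFrom
    {U | ∃ (x : X) (δ : ℝ), 0 < δ ∧ δ < X.ε ∧ U = X.localStable x δ}

/-- The nonempty compact open subsets of the stable sets `X^s(x)`, as `x` varies. -/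
structure COs (X : SmaleSpace.{u}) where
  carrier : Set X
  nonempty : carrier.Nonempty
  subset_stable : ∃ x : X, carrier ⊆ X.stableSet x
  isOpen : IsOpen[X.stableTopology] carrier
  isCompact : @IsCompact X X.stableTopology carrier

/-- The smallest equivalence relation on the compact open subsets of stable sets such that
`E ∼ F` whenever `E`, `F` lie in local stable sets, `[E, F]` and `[F, E]` are defined,
`[E, F] = E` and `[F, E] = F`, and such that `E ∼ F` if and only if `φ(E) ∼ φ(F)`. -/
inductive COs.Equiv (X : SmaleSpace.{u}) : X.COs → X.COs → Prop
  | bracket (E F : X.COs)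
      (hEloc : ∃ x, E.carrier ⊆ X.localStable x X.ε)
      (hFloc : ∃ y, F.carrier ⊆ X.localStable y X.ε)
      (hdef : ∀ x ∈ E.carrier, ∀ y ∈ F.carrier, dist x y ≤ X.ε)
      (hE : Set.image2 X.bracket E.carrier F.carrier = E.carrier)
      (hF : Set.image2 X.bracket F.carrier E.carrier = F.carrier) : COs.Equiv X E F
  | image (E F E' F' : X.COs) (hE : E'.carrier = X.φ '' E.carrier)
      (hF : F'.carrier = X.φ '' F.carrier) (h : COs.Equiv X E F) : COs.Equiv X E' F'
  | preimage (E F E' F' : X.COs) (hE : E'.carrier = X.φ '' E.carrier)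
      (hF : F'.carrier = X.φ '' F.carrier) (h : COs.Equiv X E' F') : COs.Equiv X E F
  | refl (E : X.COs) : COs.Equiv X E E
  | symm (E F : X.COs) (h : COs.Equiv X E F) : COs.Equiv X F E
  | trans (E F K : X.COs) (h₁ : COs.Equiv X E F) (h₂ : COs.Equiv X F K) : COs.Equiv X E K

/-- The relations defining `D^s(X, φ)`: equivalent sets have equal classes, and
`[E ∪ F] = [E] + [F]` for disjoint `E`, `F`. -/
def relS (X : SmaleSpace.{u}) : AddSubgroup (FreeAbelianGroup X.COs) :=
  AddSubgroup.closure
    ({a | ∃ E F : X.COs, COs.Equiv X E F ∧ a = FreeAbelianGroup.of E - FreeAbelianGroup.of F} ∪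
     {a | ∃ E F K : X.COs, Disjoint E.carrier F.carrier ∧ K.carrier = E.carrier ∪ F.carrier ∧
        a = FreeAbelianGroup.of K - FreeAbelianGroup.of E - FreeAbelianGroup.of F})

/-- The stable dimension group `D^s(X, φ)` (for totally disconnected `X`, that is, shifts of
finite type): generated by the compact open subsets of stable sets. -/
abbrev Ds (X : SmaleSpace.{u}) : Type u := FreeAbelianGroup X.COs ⧸ X.relS

/-- The class `[E]` in `D^s(X, φ)`. -/
def clsS (X : SmaleSpace.{u}) (E : X.COs) : X.Ds :=
  QuotientAddGroup.mk (FreeAbelianGroup.of E)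

/-- The unstable dimension group `D^u(X, φ) = D^s(X, φ⁻¹)`. -/
abbrev Du (X : SmaleSpace.{u}) : Type u := X.inv.Ds

end SmaleSpace

/-! ## Maps and correspondences -/

/-- A map of Smale spaces: a continuous function intertwining the dynamics. -/
structure SmaleMap (X : SmaleSpace.{u}) (Y : SmaleSpace.{v}) where
  toFun : X → Y
  continuous : Continuous toFun
  comm : ∀ x, toFun (X.φ x) = Y.φ (toFun x)

namespace SmaleMap

variable {X : SmaleSpace.{u}} {Y : SmaleSpace.{v}}

/-- `π` maps each stable set `X^s(x)` bijectively onto `Y^s(π x)`. -/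
def SBijective (π : SmaleMap X Y) : Prop :=
  ∀ x : X, Set.BijOn π.toFun (X.stableSet x) (Y.stableSet (π.toFun x))

/-- `π` maps each unstable set `X^u(x)` bijectively onto `Y^u(π x)`. -/
def UBijective (π : SmaleMap X Y) : Prop :=
  ∀ x : X, Set.BijOn π.toFun (X.unstableSet x) (Y.unstableSet (π.toFun x))

/-- The same map, between the inverse Smale spaces. -/
abbrev inv (π : SmaleMap X Y) : SmaleMap X.inv Y.inv where
  toFun := π.toFun
  continuous := π.continuous
  comm := fun x => by
    apply Y.φ.injective
    have := π.comm (X.φ.symm x)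
    simp only [Homeomorph.apply_symm_apply] at this
    simpa using this.symm

/-- `f` is the homomorphism `π^s : D^s(X) → D^s(Y)` induced by an s-bijective factor map `π`:
`π^s [E] = [π(E)]`. -/
def IsPushS (π : SmaleMap X Y) (f : X.Ds →+ Y.Ds) : Prop :=
  ∀ E : X.COs, ∃ E' : Y.COs, E'.carrier = π.toFun '' E.carrier ∧ f (X.clsS E) = Y.clsS E'

/-- `f` is the homomorphism `π^{s*} : D^s(Y) → D^s(X)` induced by a u-bijective factor map `π`:
`π^{s*} [E] = ∑ k, [F k]`, where `π⁻¹(E)` is the disjoint union of the finitely many compact open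
sets `F k`, the sets `F k` lying in pairwise different stable equivalence classes. -/
def IsPullS (π : SmaleMap X Y) (f : Y.Ds →+ X.Ds) : Prop :=
  ∀ E : Y.COs, ∃ (n : ℕ) (F : Fin n → X.COs),
    π.toFun ⁻¹' E.carrier = ⋃ k, (F k).carrier ∧
    (∀ k l, k ≠ l → ∀ x ∈ (F k).carrier, ∀ y ∈ (F l).carrier, y ∉ X.stableSet x) ∧
    f (Y.clsS E) = ∑ k, X.clsS (F k)

/-- `f` is the homomorphism `π^u : D^u(X) → D^u(Y)` induced by a u-bijective factor map `π`. -/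
def IsPushU (π : SmaleMap X Y) (f : X.Du →+ Y.Du) : Prop := π.inv.IsPushS f

/-- `f` is the homomorphism `π^{u*} : D^u(Y) → D^u(X)` induced by an s-bijective factor
map `π`. -/
def IsPullU (π : SmaleMap X Y) (f : Y.Du →+ X.Du) : Prop := π.inv.IsPullS f

end SmaleMap

/-- A correspondence `X ← M → Y` from `X` to `Y` with middle space `M`. -/
structure Correspondence (X M Y : SmaleSpace.{u}) where
  πu : SmaleMap M X
  πs : SmaleMap M Y
  uBijective : πu.UBijective
  sBijective : πs.SBijective

/-! ## Inductive limits of integer matrices -/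

section DimGroup

variable {n m : Type u} [Fintype n] [DecidableEq n] [Fintype m] [DecidableEq m]

/-- The inductive limit of `ℤⁿ → ℤⁿ → ℤⁿ → ⋯`, all of whose maps are `v ↦ A v`. -/
abbrev DimGroup (A : Matrix n n ℤ) : Type u :=
  Module.DirectLimit (R := ℤ) (fun _ : ℕ => n → ℤ)
    (fun i j (_ : i ≤ j) => (A ^ (j - i)).mulVecLin)

/-- The element `[v, j]` of the inductive limit. -/
noncomputable def DimGroup.mk (A : Matrix n n ℤ) (v : n → ℤ) (j : ℕ) : DimGroup A :=
  Module.DirectLimit.of ℤ ℕ (fun _ : ℕ => n → ℤ)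
    (fun i j (_ : i ≤ j) => (A ^ (j - i)).mulVecLin) j v

theorem DimGroup.intertwine_pow (A : Matrix n n ℤ) (B : Matrix m m ℤ) (F : Matrix m n ℤ)
    (h : F * A = B * F) (k : ℕ) : F * A ^ k = B ^ k * F := by
  induction k with
  | zero => simp
  | succ k ih => rw [pow_succ, ← Matrix.mul_assoc, ih, Matrix.mul_assoc, h, ← Matrix.mul_assoc,
      ← pow_succ]

/-- The homomorphism `[v, j] ↦ [F v, j]` of inductive limits, for `F A = B F`. -/
noncomputable def DimGroup.map (A : Matrix n n ℤ) (B : Matrix m m ℤ) (F : Matrix m n ℤ)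
    (h : F * A = B * F) : DimGroup A →+ DimGroup B :=
  (Module.DirectLimit.map (fun _ => F.mulVecLin) (fun i j _ => by
    rw [← Matrix.mulVecLin_mul, ← Matrix.mulVecLin_mul,
      DimGroup.intertwine_pow A B F h])).toAddMonoidHom

theorem DimGroup.map_mk (A : Matrix n n ℤ) (B : Matrix m m ℤ) (F : Matrix m n ℤ)
    (h : F * A = B * F) (v : n → ℤ) (j : ℕ) :
    DimGroup.map A B F h (DimGroup.mk A v j) = DimGroup.mk B (F.mulVec v) j := by
  exact Module.DirectLimit.map_apply_of (R := ℤ) (G := fun _ : ℕ => n → ℤ)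
    (G' := fun _ : ℕ => m → ℤ)
    (f := fun i j (_ : i ≤ j) => (A ^ (j - i)).mulVecLin)
    (f' := fun i j (_ : i ≤ j) => (B ^ (j - i)).mulVecLin)
    (g := fun _ => F.mulVecLin) (fun i j _ => by
      rw [← Matrix.mulVecLin_mul, ← Matrix.mulVecLin_mul,
        DimGroup.intertwine_pow A B F h]) v

end DimGroup

/-! ## Graphs and shifts of finite type -/

/-- A finite directed graph (multiple edges and loops allowed) with no sources and no sinks;
the edge `e` goes from `i e` to `t e`. -/
structure FinGraph where
  V : Type u
  E : Type u
  [fintypeV : Fintype V]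
  [decEqV : DecidableEq V]
  [finiteE : Finite E]
  i : E → V
  t : E → V
  no_sources : ∀ v, ∃ e, t e = v
  no_sinks : ∀ v, ∃ e, i e = v

attribute [instance] FinGraph.fintypeV FinGraph.decEqV FinGraph.finiteE

namespace FinGraph

/-- The adjacency matrix: the `(v, w)` entry is the number of edges from `v` to `w`. -/
noncomputable def adj (G : FinGraph.{u}) : Matrix G.V G.V ℕ :=
  Matrix.of fun v w => Nat.card {e : G.E // G.i e = v ∧ G.t e = w}

/-- The adjacency matrix with integer entries. -/
noncomputable def adjZ (G : FinGraph.{u}) : Matrix G.V G.V ℤ := G.adj.map (Nat.cast : ℕ → ℤ)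

/-- A graph is irreducible if there is a path from any vertex to any other. -/
def Irreducible (G : FinGraph.{u}) : Prop :=
  ∀ v w : G.V, Relation.ReflTransGen (fun a b => ∃ e, G.i e = a ∧ G.t e = b) v w

/-- The space of bi-infinite paths in `G`. -/
structure Path (G : FinGraph.{u}) : Type u where
  edge : ℤ → G.E
  chain : ∀ k, G.t (edge k) = G.i (edge (k + 1))

variable {G : FinGraph.{u}}

instance : CoeFun G.Path (fun _ => ℤ → G.E) := ⟨Path.edge⟩

theorem Path.edge_injective : Function.Injective (Path.edge : G.Path → ℤ → G.E) := by
  rintro ⟨x, hx⟩ ⟨y, hy⟩ h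
  cases h
  rfl

theorem Path.ext {x y : G.Path} (h : ∀ k, x k = y k) : x = y := Path.edge_injective (funext h)

/-- The product topology, `G.E` being discrete. -/
instance : TopologicalSpace G.Path :=
  TopologicalSpace.induced Path.edge (@Pi.topologicalSpace ℤ (fun _ => G.E) (fun _ => ⊥))

/-- `x` and `y` agree at the places `1 - K, …, K`. -/
def Path.Agree (x y : G.Path) (K : ℕ) : Prop := ∀ k : ℤ, 1 - (K : ℤ) ≤ k → k ≤ K → x k = y k

/-- The metric: the infimum of the `2^{-K}` such that `x` and `y` agree at `1 - K, …, K`. -/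
noncomputable def Path.d (x y : G.Path) : ℝ := sInf {r | ∃ K : ℕ, x.Agree y K ∧ r = (1 / 2) ^ K}

theorem Path.agree_zero (x y : G.Path) : x.Agree y 0 := by
  intro k h1 h2
  simp only [Nat.cast_zero] at h1 h2
  omega

theorem Path.Agree.mono {x y : G.Path} {K L : ℕ} (h : x.Agree y K) (hL : L ≤ K) :
    x.Agree y L := fun k h1 h2 => h k (by omega) (by omega)

theorem Path.d_bddBelow (x y : G.Path) :
    BddBelow {r : ℝ | ∃ K : ℕ, x.Agree y K ∧ r = (1 / 2) ^ K} :=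
  ⟨0, by rintro r ⟨K, -, rfl⟩; positivity⟩

theorem Path.d_set_nonempty (x y : G.Path) :
    {r : ℝ | ∃ K : ℕ, x.Agree y K ∧ r = (1 / 2) ^ K}.Nonempty :=
  ⟨1, 0, Path.agree_zero x y, by simp⟩

theorem Path.d_nonneg (x y : G.Path) : 0 ≤ x.d y :=
  Real.sInf_nonneg (by rintro r ⟨K, -, rfl⟩; positivity)

theorem Path.le_d {x y : G.Path} {c : ℝ} (h : ∀ K : ℕ, x.Agree y K → c ≤ (1 / 2) ^ K) :
    c ≤ x.d y :=
  le_csInf (Path.d_set_nonempty x y) (by rintro r ⟨K, hK, rfl⟩; exact h K hK)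

theorem Path.d_le_iff {x y : G.Path} {K : ℕ} : x.d y ≤ (1 / 2) ^ K ↔ x.Agree y K := by
  constructor
  · intro h
    by_contra hK
    have h2 : (1 / 2 : ℝ) ^ K < x.d y := by
      obtain ⟨L, rfl⟩ : ∃ L, K = L + 1 :=
        ⟨K - 1, by
          rcases K with _ | K
          · exact absurd (Path.agree_zero x y) hK
          · rfl⟩
      refine lt_of_lt_of_le (b := (1 / 2 : ℝ) ^ L) ?_ (Path.le_d ?_)
      · exact pow_lt_pow_right_of_lt_one₀ (by norm_num) (by norm_num) (Nat.lt_succ_self L)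
      · intro M hM
        refine pow_le_pow_of_le_one (by norm_num) (by norm_num) ?_
        by_contra hlt
        exact hK (hM.mono (by omega))
    linarith
  · intro h
    exact csInf_le (Path.d_bddBelow x y) ⟨K, h, rfl⟩

theorem Path.d_self (x : G.Path) : x.d x = 0 := by
  refine le_antisymm ?_ (Path.d_nonneg x x)
  refine ge_of_tendsto' (tendsto_pow_atTop_nhds_zero_of_lt_one (r := (1 / 2 : ℝ))
    (by norm_num) (by norm_num)) (fun K => Path.d_le_iff.2 (fun k _ _ => rfl))

theorem Path.Agree.symm {x y : G.Path} {K : ℕ} (h : x.Agree y K) : y.Agree x K :=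
  fun k h1 h2 => (h k h1 h2).symm

theorem Path.d_comm (x y : G.Path) : x.d y = y.d x :=
  le_antisymm (Path.le_d fun _ hK => Path.d_le_iff.2 hK.symm)
    (Path.le_d fun _ hK => Path.d_le_iff.2 hK.symm)

theorem Path.d_le_max (x y z : G.Path) : x.d z ≤ max (x.d y) (y.d z) := by
  by_contra h
  push Not at h
  obtain ⟨h1, h2⟩ := max_lt_iff.1 h
  obtain ⟨r, ⟨K, hK, rfl⟩, hr⟩ := exists_lt_of_csInf_lt (Path.d_set_nonempty x y) h1
  obtain ⟨r, ⟨L, hL, rfl⟩, hr'⟩ := exists_lt_of_csInf_lt (Path.d_set_nonempty y z) h2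
  rcases le_total K L with hKL | hKL
  · have : x.Agree z K := fun k a b => (hK k a b).trans (hL.mono hKL k a b)
    exact absurd (Path.d_le_iff.2 this) (not_le.2 hr)
  · have : x.Agree z L := fun k a b => (hK.mono hKL k a b).trans (hL k a b)
    exact absurd (Path.d_le_iff.2 this) (not_le.2 hr')

theorem Path.d_triangle (x y z : G.Path) : x.d z ≤ x.d y + y.d z :=
  (Path.d_le_max x y z).trans
    (max_le_add_of_nonneg (Path.d_nonneg x y) (Path.d_nonneg y z))

theorem Path.eq_of_d_eq_zero (x y : G.Path) (h : x.d y = 0) : x = y := by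
  refine Path.ext fun k => ?_
  have : x.Agree y (k.natAbs + 1) := Path.d_le_iff.1 (by rw [h]; positivity)
  exact this k (by omega) (by omega)

theorem Path.continuous_coord (k : ℤ) :
    @Continuous G.Path G.E _ ⊥ (fun x : G.Path => x k) := by
  let _ : TopologicalSpace G.E := ⊥
  exact (continuous_apply k).comp continuous_induced_dom

theorem Path.continuousOn_iff {Z : Type*} [TopologicalSpace Z] {f : Z → G.Path} {s : Set Z} :
    ContinuousOn f s ↔ ∀ k : ℤ, @ContinuousOn Z G.E _ ⊥ (fun z => f z k) s := by
  let _ : TopologicalSpace G.E := ⊥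
  have hind : Topology.IsInducing (Path.edge : G.Path → ℤ → G.E) := ⟨rfl⟩
  rw [hind.continuousOn_iff, continuousOn_pi]
  rfl

theorem Path.continuous_iff {Z : Type*} [TopologicalSpace Z] {f : Z → G.Path} :
    Continuous f ↔ ∀ k : ℤ, @Continuous Z G.E _ ⊥ (fun z => f z k) := by
  let _ : TopologicalSpace G.E := ⊥
  simp only [← continuousOn_univ]
  exact Path.continuousOn_iff

theorem Path.isOpen_agree (x : G.Path) (K : ℕ) : IsOpen {y : G.Path | x.Agree y K} := by
  let _ : TopologicalSpace G.E := ⊥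
  have : DiscreteTopology G.E := ⟨rfl⟩
  have : {y : G.Path | x.Agree y K} =
      ⋂ k ∈ Set.Icc (1 - (K : ℤ)) K, {y : G.Path | y k = x k} := by
    ext y
    simp only [Set.mem_ofPred_eq, Set.mem_iInter, Set.mem_Icc, and_imp, Path.Agree]
    exact ⟨fun h k a b => (h k a b).symm, fun h k a b => (h k a b).symm⟩
  rw [this]
  exact (Set.finite_Icc _ _).isOpen_biInter fun k _ =>
    (isOpen_discrete {x k}).preimage (Path.continuous_coord k)

theorem Path.isOpen_iff (s : Set G.Path) :
    IsOpen s ↔ ∀ x ∈ s, ∃ ε > 0, ∀ y, x.d y < ε → y ∈ s := by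
  let _ : TopologicalSpace G.E := ⊥
  have : DiscreteTopology G.E := ⟨rfl⟩
  constructor
  · rintro ⟨t, ht, rfl⟩ x hx
    obtain ⟨I, U, hU, hIU⟩ := isOpen_pi_iff.1 ht x.edge hx
    obtain ⟨K, hK⟩ : ∃ K : ℕ, ∀ k ∈ I, 1 - (K : ℤ) ≤ k ∧ k ≤ K := by
      refine ⟨I.sup Int.natAbs + 1, fun k hk => ?_⟩
      have := Finset.le_sup (f := Int.natAbs) hk
      omega
    refine ⟨(1 / 2) ^ K, by positivity, fun y hy => hIU ?_⟩
    intro k hk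
    have := Path.d_le_iff.1 hy.le k (hK k hk).1 (hK k hk).2
    rw [← this]
    exact (hU k hk).2
  · intro h
    rw [isOpen_iff_mem_nhds]
    intro x hx
    obtain ⟨ε, hε, hs⟩ := h x hx
    obtain ⟨K, hK⟩ := exists_pow_lt_of_lt_one hε (show (1 / 2 : ℝ) < 1 by norm_num)
    refine Filter.mem_of_superset ((Path.isOpen_agree x K).mem_nhds (fun k _ _ => rfl)) ?_
    intro y hy
    exact hs y ((Path.d_le_iff.2 hy).trans_lt hK)

noncomputable instance : MetricSpace G.Path :=
  MetricSpace.ofDistTopology Path.d Path.d_self Path.d_comm Path.d_triangle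
    Path.isOpen_iff Path.eq_of_d_eq_zero

theorem Path.dist_eq (x y : G.Path) : dist x y = x.d y := rfl

instance : CompactSpace G.Path := by
  let _ : TopologicalSpace G.E := ⊥
  have : DiscreteTopology G.E := ⟨rfl⟩
  have hcl : IsClosed {x : ℤ → G.E | ∀ k, G.t (x k) = G.i (x (k + 1))} := by
    rw [Set.ofPred_forall]
    refine isClosed_iInter fun k => ?_
    have h : Continuous fun x : ℤ → G.E => (x k, x (k + 1)) :=
      (continuous_apply k).prodMk (continuous_apply (k + 1))
    exact (isClosed_discrete {p : G.E × G.E | G.t p.1 = G.i p.2}).preimage h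
  have hind : Topology.IsInducing (Path.edge : G.Path → ℤ → G.E) := ⟨rfl⟩
  have hr : Set.range (Path.edge : G.Path → ℤ → G.E) =
      {x : ℤ → G.E | ∀ k, G.t (x k) = G.i (x (k + 1))} := by
    ext x
    exact ⟨by rintro ⟨y, rfl⟩; exact y.chain, fun h => ⟨⟨x, h⟩, rfl⟩⟩
  refine ⟨hind.isCompact_iff.2 ?_⟩
  rw [Set.image_univ, hr]
  exact hcl.isCompact

/-- The shift map `σ(x)^k = x^{k+1}`. -/
def σ (G : FinGraph.{u}) : G.Path ≃ₜ G.Path where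
  toFun x := ⟨fun k => x (k + 1), fun k => x.chain (k + 1)⟩
  invFun x := ⟨fun k => x (k - 1), fun k => by
    have h := x.chain (k - 1)
    rwa [show k - 1 + 1 = k + 1 - 1 by ring] at h⟩
  left_inv x := Path.ext fun k => congrArg x.edge (by ring)
  right_inv x := Path.ext fun k => congrArg x.edge (by ring)
  continuous_toFun := Path.continuous_iff.2 fun k => Path.continuous_coord (k + 1)
  continuous_invFun := Path.continuous_iff.2 fun k => Path.continuous_coord (k - 1)

theorem σ_apply (x : G.Path) (k : ℤ) : G.σ x k = x (k + 1) := rfl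

theorem σ_symm_apply (x : G.Path) (k : ℤ) : G.σ.symm x k = x (k - 1) := rfl

/-- The past of `y` (places `≤ 0`) followed by the future of `x` (places `≥ 1`). -/
def Path.glue (x y : G.Path) (h : G.t (x 0) = G.t (y 0)) : G.Path :=
  ⟨fun k => if k ≤ 0 then y k else x k, fun k => by
    rcases lt_trichotomy k 0 with hk | rfl | hk
    · rw [if_pos hk.le, if_pos (by omega)]
      exact y.chain k
    · rw [if_pos le_rfl, if_neg (by omega), ← h]
      exact x.chain 0
    · rw [if_neg (by omega), if_neg (by omega)]
      exact x.chain k⟩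

/-- The bracket `[x, y]`: the past of `y` followed by the future of `x` if `t(x⁰) = t(y⁰)`, and
a junk value otherwise. -/
def Path.bracket (x y : G.Path) : G.Path :=
  if h : G.t (x 0) = G.t (y 0) then x.glue y h else x

theorem Path.agree_one_of_dist {x y : G.Path} (h : dist x y ≤ 1 / 2) : x.Agree y 1 :=
  Path.d_le_iff.1 (by simpa [Path.dist_eq] using h)

theorem Path.bracket_apply {x y : G.Path} (h : dist x y ≤ 1 / 2) (k : ℤ) :
    x.bracket y k = if k ≤ 0 then y k else x k := by
  have h0 : G.t (x 0) = G.t (y 0) :=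
    congrArg G.t (Path.agree_one_of_dist h 0 (by norm_num) (by norm_num))
  rw [Path.bracket, dif_pos h0]
  rfl

theorem Path.contract {x y x' y' : G.Path} (h : ∀ K, 1 ≤ K → x.Agree y K → x'.Agree y' (K + 1))
    (hd : dist x y ≤ 1 / 2) : dist x' y' ≤ 1 / 2 * dist x y := by
  have : 2 * x'.d y' ≤ x.d y := by
    refine Path.le_d fun K hK => ?_
    have hK' : x.Agree y (max K 1) := by
      rcases le_total K 1 with h1 | h1
      · rw [max_eq_right h1]; exact Path.agree_one_of_dist hd
      · rwa [max_eq_left h1]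
    have := Path.d_le_iff.2 ((h _ (le_max_right _ _) hK').mono
      (Nat.succ_le_succ (le_max_left K 1)))
    rw [pow_succ] at this
    linarith
  rw [Path.dist_eq, Path.dist_eq]
  linarith

/-- The shift of finite type `(Σ_G, σ)` as a Smale space. -/
noncomputable abbrev shift (G : FinGraph.{u}) : SmaleSpace.{u} where
  carrier := G.Path
  φ := G.σ
  ε := 1 / 2
  ε_pos := by norm_num
  lam := 1 / 2
  lam_pos := by norm_num
  lam_lt_one := by norm_num
  bracket := Path.bracket
  bracket_continuous := by
    let _ : TopologicalSpace G.E := ⊥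
    rw [Path.continuousOn_iff]
    intro k
    have h : Continuous fun p : G.Path × G.Path => if k ≤ 0 then p.2 k else p.1 k := by
      split_ifs
      · exact (Path.continuous_coord k).comp continuous_snd
      · exact (Path.continuous_coord k).comp continuous_fst
    exact h.continuousOn.congr fun p hp => Path.bracket_apply hp k
  B1 := fun x => Path.ext fun k => by
    rw [Path.bracket_apply (by simp), ite_self]
  B2 := fun x y z h1 h2 h3 => Path.ext fun k => by
    rw [Path.bracket_apply h2, Path.bracket_apply h1, Path.bracket_apply h3]
    split_ifs <;> rfl
  B3 := fun x y z h1 h2 h3 => Path.ext fun k => by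
    rw [Path.bracket_apply h2, Path.bracket_apply h1, Path.bracket_apply h3]
    split_ifs <;> rfl
  B4 := fun x y h1 h2 => Path.ext fun k => by
    rw [σ_apply, Path.bracket_apply h1, Path.bracket_apply h2, σ_apply, σ_apply]
    rcases lt_trichotomy k 0 with hk | rfl | hk
    · rw [if_pos (by omega), if_pos hk.le]
    · rw [if_neg (by omega), if_pos le_rfl]
      exact Path.agree_one_of_dist h1 _ (by norm_num) (by norm_num)
    · rw [if_neg (by omega), if_neg (by omega)]
  C1 := fun x y h1 h2 => Path.contract (fun K hK hA k a b => by
    rw [σ_apply, σ_apply]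
    by_cases hk : k + 1 ≤ 0
    · exact hA _ (by push_cast at a; omega) (by omega)
    · have := Path.bracket_apply h1 (k + 1)
      rw [h2, if_neg hk] at this
      exact this.symm) h1
  C2 := fun x y h1 h2 => Path.contract (fun K hK hA k a b => by
    rw [σ_symm_apply, σ_symm_apply]
    by_cases hk : k - 1 ≤ 0
    · have := Path.bracket_apply h1 (k - 1)
      rw [h2, if_pos hk] at this
      exact this
    · exact hA _ (by omega) (by push_cast at b; omega)) h1

/-! ### Krieger's dimension groups of `Σ_G` -/

/-- `D^s(Σ_G, σ)` as the inductive limit of `A_G`. -/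
abbrev DimS (G : FinGraph.{u}) : Type u := DimGroup G.adjZ

/-- `D^u(Σ_G, σ)` as the inductive limit of the transpose of `A_G`. -/
abbrev DimU (G : FinGraph.{u}) : Type u := DimGroup G.adjZ.transpose

/-- `θ` is the canonical identification of the two descriptions of `D^s(Σ_G, σ)`: for a path `x`
with `i(x^{1-j}) = v`, the element `[δ_v, j]` of the inductive limit corresponds to the class of
the set of all paths that agree with `x` at all places `≥ 1 - j`. -/
def IsIdentS (G : FinGraph.{u}) (θ : G.DimS ≃+ G.shift.Ds) : Prop :=
  ∀ (x : G.Path) (j : ℕ), ∃ E : G.shift.COs,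
    E.carrier = {y : G.Path | ∀ k : ℤ, 1 - (j : ℤ) ≤ k → y k = x k} ∧
    θ (DimGroup.mk G.adjZ (Pi.single (G.i (x (1 - (j : ℤ)))) 1) j) = G.shift.clsS E

/-- `θ` is the canonical identification of the two descriptions of `D^u(Σ_G, σ)`: for a path `x`
with `t(x^j) = v`, the element `[δ_v, j]` of the inductive limit corresponds to the class of
the set of all paths that agree with `x` at all places `≤ j`. -/
def IsIdentU (G : FinGraph.{u}) (θ : G.DimU ≃+ G.shift.Du) : Prop :=
  ∀ (x : G.Path) (j : ℕ), ∃ E : G.shift.inv.COs,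
    E.carrier = {y : G.Path | ∀ k : ℤ, k ≤ (j : ℤ) → y k = x k} ∧
    θ (DimGroup.mk G.adjZ.transpose (Pi.single (G.t (x (j : ℤ))) 1) j) = G.shift.inv.clsS E

theorem adjZ_intertwine {G H : FinGraph.{u}} (F : Matrix H.V G.V ℕ)
    (h : F * G.adj = H.adj * F) :
    F.map (Nat.cast : ℕ → ℤ) * G.adjZ = H.adjZ * F.map (Nat.cast : ℕ → ℤ) := by
  have := congrArg (fun A : Matrix H.V G.V ℕ => A.map (Nat.castRingHom ℤ)) h
  rw [Matrix.map_mul, Matrix.map_mul] at this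
  exact this

/-- `F_* : D^s(Σ_G, σ) → D^s(Σ_H, σ)`, `[v, j] ↦ [F v, j]`. -/
noncomputable def lowerStar {G H : FinGraph.{u}} (F : Matrix H.V G.V ℕ) (h : F * G.adj = H.adj * F) :
    G.DimS →+ H.DimS :=
  DimGroup.map G.adjZ H.adjZ (F.map (Nat.cast : ℕ → ℤ)) (adjZ_intertwine F h)

/-- `F^* : D^u(Σ_H, σ) → D^u(Σ_G, σ)`, `[v, j] ↦ [Fᵗ v, j]`. -/
noncomputable def upperStar {G H : FinGraph.{u}} (F : Matrix H.V G.V ℕ) (h : F * G.adj = H.adj * F) :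
    H.DimU →+ G.DimU :=
  DimGroup.map H.adjZ.transpose G.adjZ.transpose (F.map (Nat.cast : ℕ → ℤ)).transpose (by
    rw [← Matrix.transpose_mul, ← Matrix.transpose_mul, adjZ_intertwine F h])

end FinGraph

/-! Regard `F` as a bipartite graph with `F w v` arrows from `w` to `v`. The equation `F A_G = A_H
F` says that between any `w` and `v` there are as many paths "arrow, then edge of `G`" as paths
"edge of `H`, then arrow". Choose a bijection between the two kinds of paths that keeps both ends;
every matched pair is a commuting square. Let `M` have the arrows as vertices and the squares as
edges, a square going from the arrow of its first path to the arrow of its second (`coverGraph`).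
Reading off the edge of `G` or of `H` gives homomorphisms `p : M → G` and `q : M → H`. A square is
determined by its initial arrow and its edge of `G`, and also by its terminal arrow and its edge of
`H`. Hence `p` lifts edges uniquely forwards and `q` lifts them uniquely backwards. Stably
equivalent paths are those with a common future from some place on, so unique backward lifting makes
the map of `q` s-bijective; by symmetry the map of `p` is u-bijective.

A compact open subset of a stable set is a finite union of cylinders, each fixing the ray from a
place `n` on. The class of a cylinder depends only on `n` and the initial vertex of the ray
(`rcls_eq_of_start_eq`), and splitting it by the preceding edge is multiplication by `A_G`
(`vcls_eq_sum`). Conversely, counting the rays of a set by initial vertex is invariant under the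
equivalence relation (`countVec_eq_of_equiv`). This identifies `D^s` with the inductive limit
(`ident`).

On these counts the pushforward along `q` sums over the fibres of `q` on vertices (`isPushS`), and
the pullback along `p` composes with `p` on vertices (`isPullS`). The composite matrix counts the
arrows from `w` to `v`, so it is `F` (`exists_covering`).

The inverse of a shift is the shift of the reversed graph. A `Coding` records what the argument
needs of a shift, so the stable case is proved once and then applied to both. -/

namespace FinGraph

/-! ### Reversed graphs and one-sided paths -/

/-- The graph with all edges reversed. -/
abbrev rev (G : FinGraph.{u}) : FinGraph.{u} where
  V := G.V
  E := G.E
  i := G.t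
  t := G.i
  no_sources := G.no_sinks
  no_sinks := G.no_sources

/-- The one-sided infinite paths in `G`. -/
structure Ray (G : FinGraph.{u}) : Type u where
  edge : ℕ → G.E
  chain : ∀ k, G.t (edge k) = G.i (edge (k + 1))

variable {G : FinGraph.{u}}

theorem Ray.ext {f g : G.Ray} (h : ∀ k, f.edge k = g.edge k) : f = g := by
  cases f; cases g
  simp only [Ray.mk.injEq]
  exact funext h

/-- The initial vertex of a ray. -/
def Ray.start (f : G.Ray) : G.V := G.i (f.edge 0)

/-- The part of a bi-infinite path from the place `n` on. -/
def Path.ray (x : G.Path) (n : ℤ) : G.Ray where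
  edge k := x (n + k)
  chain k := by
    have := x.chain (n + k)
    rw [this]
    push_cast
    rw [add_assoc]

theorem Path.ray_edge (x : G.Path) (n : ℤ) (k : ℕ) : (x.ray n).edge k = x (n + k) := rfl

theorem Path.ray_start (x : G.Path) (n : ℤ) : (x.ray n).start = G.i (x n) := by
  rw [Ray.start, Path.ray_edge, Nat.cast_zero, add_zero]

theorem Path.ray_eq_iff {x : G.Path} {n : ℤ} {f : G.Ray} :
    x.ray n = f ↔ ∀ k : ℕ, x (n + k) = f.edge k :=
  ⟨fun h k => by rw [← h]; rfl, fun h => Ray.ext h⟩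

theorem Path.ray_eq_ray_iff {x y : G.Path} {n : ℤ} :
    x.ray n = y.ray n ↔ ∀ k, n ≤ k → x k = y k := by
  rw [Path.ray_eq_iff]
  refine ⟨fun h k hk => ?_, fun h k => h _ (by omega)⟩
  have := h (k - n).toNat
  rwa [Path.ray_edge, show n + ((k - n).toNat : ℤ) = k by omega] at this

/-- A ray extends to the left to a bi-infinite path, along edges chosen step by step. -/
theorem Ray.exists_path (r : G.Ray) (n : ℤ) (P : ℤ → G.V → Prop) (R : ℤ → G.E → Prop)
    (h0 : P (n - 1) r.start)
    (hs : ∀ k v, P k v → ∃ e, G.t e = v ∧ R k e ∧ P (k - 1) (G.i e)) :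
    ∃ x : G.Path, x.ray n = r ∧ ∀ k < n, R k (x k) := by
  have : Nonempty G.E := ⟨r.edge 0⟩
  choose! e he hR hP using hs
  -- `s k` is the vertex where the edge at place `n - 1 - k` must end; `P` is the invariant that
  -- these vertices keep on the way to the left.
  let s : ℕ → G.V := fun k => Nat.rec r.start (fun j v => G.i (e (n - 1 - j) v)) k
  have s_succ : ∀ k, s (k + 1) = G.i (e (n - 1 - k) (s k)) := fun k => rfl
  have hs : ∀ k : ℕ, P (n - 1 - k) (s k) := by
    intro k
    induction k with
    | zero => rw [Nat.cast_zero, sub_zero]; exact h0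
    | succ k ih =>
      rw [s_succ]
      have := hP _ _ ih
      rwa [show n - 1 - (k : ℤ) - 1 = n - 1 - ((k + 1 : ℕ) : ℤ) by push_cast; ring] at this
  let l : ℕ → G.E := fun k => e (n - 1 - k) (s k)
  have hl : ∀ k, G.t (l k) = s k := fun k => he _ _ (hs k)
  have hlR : ∀ k : ℕ, R (n - 1 - k) (l k) := fun k => hR _ _ (hs k)
  refine ⟨⟨fun k => if n ≤ k then r.edge (k - n).toNat else l (n - 1 - k).toNat, fun k => ?_⟩,
    Ray.ext fun k => ?_, fun k hk => ?_⟩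
  · rcases lt_trichotomy (k + 1) n with h | h | h
    · rw [if_neg (by omega), if_neg (by omega), hl,
        show (n - 1 - k).toNat = (n - 1 - (k + 1)).toNat + 1 by omega, s_succ]
    · rw [if_neg (by omega), if_pos (by omega), hl, show (n - 1 - k).toNat = 0 by omega,
        show (k + 1 - n).toNat = 0 by omega]
      rfl
    · rw [if_pos (by omega), if_pos (by omega), r.chain,
        show (k + 1 - n).toNat = (k - n).toNat + 1 by omega]
  · change (if n ≤ n + k then r.edge (n + k - n).toNat else _) = _
    rw [if_pos (by omega), show (n + (k : ℤ) - n).toNat = k by omega]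
  · change R k (if n ≤ k then _ else l (n - 1 - k).toNat)
    rw [if_neg (by omega)]
    have := hlR (n - 1 - k).toNat
    rwa [show n - 1 - ((n - 1 - k).toNat : ℤ) = k by omega] at this

theorem Ray.exists_ray_eq (r : G.Ray) (n : ℤ) : ∃ x : G.Path, x.ray n = r := by
  obtain ⟨x, hx, -⟩ := r.exists_path n (fun _ _ => True) (fun _ _ => True) trivial
    (fun k v _ => (G.no_sources v).imp fun e he => ⟨he, trivial, trivial⟩)
  exact ⟨x, hx⟩

theorem Ray.exists_start (v : G.V) : ∃ f : G.Ray, f.start = v := by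
  choose s hs using G.no_sinks
  let a : ℕ → G.E := fun k => Nat.rec (s v) (fun _ e => s (G.t e)) k
  exact ⟨⟨a, fun k => (hs _).symm⟩, hs v⟩

/-- The ray `e f₀ f₁ …`. -/
def Ray.cons (e : G.E) (f : G.Ray) (h : G.t e = f.start) : G.Ray where
  edge k := Nat.casesOn k e f.edge
  chain k := by
    cases k with
    | zero => exact h
    | succ k => exact f.chain k

theorem Ray.cons_start (e : G.E) (f : G.Ray) (h : G.t e = f.start) :
    (Ray.cons e f h).start = G.i e := rfl

theorem Path.ray_pred (x : G.Path) (n : ℤ) (f : G.Ray) (e : G.E) (h : G.t e = f.start) :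
    x.ray (n - 1) = Ray.cons e f h ↔ x (n - 1) = e ∧ x.ray n = f := by
  rw [Path.ray_eq_iff, Path.ray_eq_iff]
  constructor
  · intro hx
    refine ⟨by have := hx 0; rwa [Nat.cast_zero, add_zero] at this, fun k => ?_⟩
    have := hx (k + 1)
    rwa [show n - 1 + ((k + 1 : ℕ) : ℤ) = n + k by push_cast; ring] at this
  · rintro ⟨h1, h2⟩ k
    cases k with
    | zero => rw [Nat.cast_zero, add_zero]; exact h1
    | succ k =>
      rw [show n - 1 + ((k + 1 : ℕ) : ℤ) = n + k by push_cast; ring]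
      exact h2 k

end FinGraph

/-! ### Codings of Smale spaces by graphs -/

open FinGraph

/-- An isomorphism of the Smale space `X` with the shift of finite type of `G`. -/
structure Coding (X : SmaleSpace.{u}) (G : FinGraph.{u}) where
  c : X ≃ G.Path
  dist_c : ∀ x y, dist (c x) (c y) = dist x y
  eps : X.ε = 1 / 2
  c_φ : ∀ x, c (X.φ x) = G.σ (c x)
  c_bracket : ∀ x y, dist x y ≤ 1 / 2 → ∀ k, c (X.bracket x y) k = if k ≤ 0 then c y k else c x k

namespace Coding

/-- The shift of finite type of `G`, coded by `G`. -/
noncomputable def ofShift (G : FinGraph.{u}) : Coding G.shift G where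
  c := Equiv.refl _
  dist_c _ _ := rfl
  eps := rfl
  c_φ _ := rfl
  c_bracket _ _ h k := FinGraph.Path.bracket_apply h k

/-- A path, read backwards. -/
def revPath (G : FinGraph.{u}) : G.Path ≃ G.rev.Path where
  -- The reflection `k ↦ 1 - k` preserves the windows `1 - K, …, K` of the metric and exchanges the
  -- places `≤ 0` and `≥ 1`, hence the two arguments of the bracket.
  toFun x := ⟨fun k => x (1 - k), fun k => by
    have := x.chain (1 - (k + 1))
    rw [show 1 - (k + 1) + 1 = 1 - k by ring] at this
    exact this.symm⟩
  invFun x := ⟨fun k => x (1 - k), fun k => by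
    have := x.chain (1 - (k + 1))
    rw [show 1 - (k + 1) + 1 = 1 - k by ring] at this
    exact this.symm⟩
  left_inv x := FinGraph.Path.ext fun k => congrArg x.edge (by ring)
  right_inv x := FinGraph.Path.ext fun k => congrArg x.edge (by ring)

theorem revPath_apply {G : FinGraph.{u}} (x : G.Path) (k : ℤ) : revPath G x k = x (1 - k) := rfl

theorem revPath_agree {G : FinGraph.{u}} {x y : G.Path} {K : ℕ} :
    (revPath G x).Agree (revPath G y) K ↔ x.Agree y K := by
  constructor
  · intro h k h1 h2
    have := h (1 - k) (by omega) (by omega)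
    rwa [revPath_apply, revPath_apply, sub_sub_cancel] at this
  · intro h k h1 h2
    exact h (1 - k) (by omega) (by omega)

/-- The inverse of the shift of finite type of `G`, coded by the reversed graph. -/
noncomputable def ofShiftInv (G : FinGraph.{u}) : Coding G.shift.inv G.rev where
  c := revPath G
  dist_c x y := by
    change sInf _ = sInf _
    simp only [revPath_agree]
  eps := rfl
  c_φ x := FinGraph.Path.ext fun k => by
    rw [σ_apply, revPath_apply, revPath_apply]
    exact congrArg x.edge (by ring)
  c_bracket x y h k := by
    have := FinGraph.Path.bracket_apply (x := y) (y := x) (by rw [dist_comm]; exact h) (1 - k)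
    rw [revPath_apply, revPath_apply, revPath_apply]
    refine this.trans ?_
    split_ifs <;> first | rfl | omega

variable {X : SmaleSpace.{u}} {G : FinGraph.{u}} (κ : Coding X G)

theorem dist_le_iff (x y : X) (K : ℕ) : dist x y ≤ (1 / 2) ^ K ↔ (κ.c x).Agree (κ.c y) K := by
  rw [← κ.dist_c, Path.dist_eq, Path.d_le_iff]

theorem dist_le_half (x y : X) : dist x y ≤ 1 / 2 ↔ (κ.c x).Agree (κ.c y) 1 := by
  rw [← dist_le_iff, pow_one]

/-! ### Stable sets, cylinders and the stable topology -/

/-- The part of the path of `x` from the place `n` on. -/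
def ray (n : ℤ) (x : X) : G.Ray := (κ.c x).ray n

theorem ray_surjective (n : ℤ) : Function.Surjective (κ.ray n) := fun r => by
  obtain ⟨x, hx⟩ := r.exists_ray_eq n
  exact ⟨κ.c.symm x, by rw [ray, Equiv.apply_symm_apply, hx]⟩

theorem ray_eq_iff {n : ℤ} {x y : X} :
    κ.ray n x = κ.ray n y ↔ ∀ k, n ≤ k → κ.c x k = κ.c y k := Path.ray_eq_ray_iff

theorem ray_mono {n m : ℤ} (h : n ≤ m) {x y : X} (hx : κ.ray n x = κ.ray n y) :
    κ.ray m x = κ.ray m y :=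
  κ.ray_eq_iff.2 fun k hk => κ.ray_eq_iff.1 hx k (h.trans hk)

theorem ray_φ (n : ℤ) (x : X) : κ.ray n (X.φ x) = κ.ray (n + 1) x := by
  refine Ray.ext fun k => ?_
  rw [ray, κ.c_φ, Path.ray_edge, σ_apply, ray, Path.ray_edge]
  exact congrArg _ (by ring)

theorem c_iterate (x : X) (n : ℕ) (k : ℤ) : κ.c (X.φ^[n] x) k = κ.c x (k + n) := by
  induction n generalizing x with
  | zero => simp
  | succ n ih =>
    rw [Function.iterate_succ_apply, ih, κ.c_φ, σ_apply]
    exact congrArg _ (by push_cast; ring)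

/-- If the `m`-th iterates are closer than `1 / 2`, they agree at place `0`, that is, the paths
agree at place `m`. Conversely, a common future fills any given window after enough shifts. -/
theorem mem_stableSet {x y : X} : y ∈ X.stableSet x ↔ ∃ n : ℤ, κ.ray n y = κ.ray n x := by
  constructor
  · intro h
    have h1 := (Metric.tendsto_atTop.1 h) (1 / 2) (by norm_num)
    obtain ⟨N, hN⟩ := h1
    refine ⟨N, κ.ray_eq_iff.2 fun k hk => ?_⟩
    have h2 := hN k.toNat (by omega)
    rw [Real.dist_0_eq_abs, abs_of_nonneg dist_nonneg] at h2
    have h3 := (κ.dist_le_half _ _).1 h2.le 0 (by norm_num) (by norm_num)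
    rw [c_iterate, c_iterate, show (0 : ℤ) + (k.toNat : ℤ) = k by omega] at h3
    exact h3.symm
  · rintro ⟨n, hn⟩
    refine Metric.tendsto_atTop.2 fun ε hε => ?_
    obtain ⟨K, hK⟩ := exists_pow_lt_of_lt_one hε (show (1 / 2 : ℝ) < 1 by norm_num)
    refine ⟨n.toNat + K, fun m hm => ?_⟩
    rw [Real.dist_0_eq_abs, abs_of_nonneg dist_nonneg]
    refine lt_of_le_of_lt ((κ.dist_le_iff _ _ _).2 fun k h1 h2 => ?_) hK
    rw [c_iterate, c_iterate]
    exact (κ.ray_eq_iff.1 hn _ (by omega)).symm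

/-- `[y, x]` has the past of `x` and the future of `y`, so it equals `x` exactly when the futures
agree; the bound on `δ` keeps the bracket defined. -/
theorem mem_localStable {x y : X} {δ : ℝ} (hδ : δ ≤ 1 / 2) :
    y ∈ X.localStable x δ ↔ dist x y < δ ∧ κ.ray 1 y = κ.ray 1 x := by
  refine and_congr_right fun h => ?_
  have hb := κ.c_bracket y x (by rw [dist_comm]; linarith)
  rw [← κ.c.injective.eq_iff, κ.ray_eq_iff]
  constructor
  · intro h1 k hk
    have := hb k
    rw [h1, if_neg (by omega)] at this
    exact this.symm
  · intro h1
    refine FinGraph.Path.ext fun k => ?_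
    rw [hb]
    split_ifs with hk
    · rfl
    · exact h1 k (by omega)

theorem isOpen_cyl (n : ℤ) (f : G.Ray) : IsOpen[X.stableTopology] {y | κ.ray n y = f} := by
  -- Closeness `(1 / 2) ^ K` controls the places `1 - K, …, K`. With `K = (1 - n).toNat + 2` these
  -- include all places from `n` to `0`, and `K ≥ 2` makes the radius strictly less than `ε = 1 /
  -- 2`, as the base of the topology demands.
  have : {y | κ.ray n y = f} = ⋃ (x : X) (_ : κ.ray n x = f),
      X.localStable x ((1 / 2) ^ ((1 - n).toNat + 2) : ℝ) := by
    have hle : ((1 / 2) ^ ((1 - n).toNat + 2) : ℝ) ≤ 1 / 2 :=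
      (pow_le_pow_of_le_one (by norm_num) (by norm_num) (show 1 ≤ (1 - n).toNat + 2 by omega)).trans
        (by norm_num)
    ext y
    simp only [Set.mem_ofPred_eq, Set.mem_iUnion, exists_prop]
    constructor
    · intro hy
      refine ⟨y, hy, (κ.mem_localStable hle).2 ⟨?_, rfl⟩⟩
      rw [dist_self]
      positivity
    · rintro ⟨x, rfl, hx⟩
      obtain ⟨h1, h2⟩ := (κ.mem_localStable hle).1 hx
      refine κ.ray_eq_iff.2 fun k hk => ?_
      rcases le_or_gt 1 k with hk1 | hk1
      · exact κ.ray_eq_iff.1 h2 k hk1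
      · exact ((κ.dist_le_iff _ _ _).1 h1.le k (by omega) (by omega)).symm
  rw [this]
  refine @isOpen_iUnion _ _ X.stableTopology _ fun x => @isOpen_iUnion _ _ X.stableTopology _
    fun _ => TopologicalSpace.isOpen_generateFrom_of_mem ⟨x, _, by positivity, ?_, rfl⟩
  rw [κ.eps]
  refine (pow_lt_pow_right_of_lt_one₀ (by norm_num) (by norm_num)
    (show 1 < (1 - n).toNat + 2 by omega)).trans_le (by norm_num)

/-- Together with `isOpen_cyl`, this makes the cylinders a base. For a local stable set, the
ultrametric inequality keeps the distance to its centre below `δ`. -/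
theorem exists_cyl_subset {E : Set X} (hE : IsOpen[X.stableTopology] E) {x : X} (hx : x ∈ E) :
    ∃ N : ℤ, ∀ y, κ.ray N y = κ.ray N x → y ∈ E := by
  induction hE with
  | basic s hs =>
    obtain ⟨z, δ, h0, hδ, rfl⟩ := hs
    rw [κ.eps] at hδ
    obtain ⟨h1, h2⟩ := (κ.mem_localStable hδ.le).1 hx
    obtain ⟨K, hK⟩ := exists_pow_lt_of_lt_one h0 (show (1 / 2 : ℝ) < 1 by norm_num)
    refine ⟨1 - K, fun y hy => (κ.mem_localStable hδ.le).2 ⟨?_, ?_⟩⟩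
    · rw [← κ.dist_c]
      refine (Path.d_le_max _ (κ.c x) _).trans_lt (max_lt ?_ ?_)
      · exact (κ.dist_c z x).trans_lt h1
      · refine (Path.d_le_iff.2 fun k hk _ => ?_).trans_lt hK
        exact (κ.ray_eq_iff.1 hy k hk).symm
    · exact (κ.ray_mono (by omega) hy).trans h2
  | univ => exact ⟨0, fun y _ => trivial⟩
  | inter s t _ _ ihs iht =>
    obtain ⟨N, hN⟩ := ihs hx.1
    obtain ⟨L, hL⟩ := iht hx.2
    exact ⟨min N L, fun y hy => ⟨hN y (κ.ray_mono (min_le_left _ _) hy),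
      hL y (κ.ray_mono (min_le_right _ _) hy)⟩⟩
  | sUnion S _ ih =>
    obtain ⟨s, hs, hxs⟩ := hx
    obtain ⟨N, hN⟩ := ih s hs hxs
    exact ⟨N, fun y hy => ⟨s, hs, hN y hy⟩⟩

theorem continuous_c : Continuous κ.c := (Isometry.of_dist_eq κ.dist_c).continuous

theorem isClosed_cyl (n : ℤ) (f : G.Ray) : IsClosed {y | κ.ray n y = f} := by
  have : {y | κ.ray n y = f} = ⋂ k : ℕ, {y | κ.c y (n + k) = f.edge k} := by
    ext y
    simp only [Set.mem_ofPred_eq, Set.mem_iInter]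
    exact Path.ray_eq_iff
  rw [this]
  refine isClosed_iInter fun k => ?_
  let _ : TopologicalSpace G.E := ⊥
  have : DiscreteTopology G.E := ⟨rfl⟩
  exact (isClosed_discrete {f.edge k}).preimage
    ((Path.continuous_coord (G := G) (n + k)).comp κ.continuous_c)

/-- The cylinder is closed, hence compact, for the metric. Its points share the future from `n` on,
so metric closeness controls the remaining places down to any `N`. Thus the identity is continuous
on it from the metric to the stable topology, and compactness carries over. -/
theorem isCompact_cyl (n : ℤ) (f : G.Ray) :
    @IsCompact X X.stableTopology {y | κ.ray n y = f} := by
  have h := (κ.isClosed_cyl n f).isCompact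
  have hc : @ContinuousOn X X _ X.stableTopology id {y | κ.ray n y = f} := by
    intro x hx
    refine (@tendsto_nhds X X.stableTopology X _ _ _).2 fun s hs hxs => ?_
    obtain ⟨N, hN⟩ := κ.exists_cyl_subset hs hxs
    refine Metric.mem_nhdsWithin_iff.2 ⟨(1 / 2) ^ (N.natAbs + n.natAbs + 1), by positivity, ?_⟩
    rintro y ⟨hy, hyn⟩
    refine hN y (κ.ray_eq_iff.2 fun k hk => ?_)
    rcases le_or_gt n k with h1 | h1
    · exact κ.ray_eq_iff.1 (hyn.trans hx.symm) k h1
    · exact (κ.dist_le_iff _ _ _).1 (Metric.mem_ball.1 hy).le k (by omega) (by omega)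
  have := @IsCompact.image_of_continuousOn X X _ X.stableTopology _ id h hc
  rwa [Set.image_id] at this

/-! ### Compact open sets as finite unions of cylinders -/

theorem COs_ext {E F : X.COs} (h : E.carrier = F.carrier) : E = F := by
  cases E; cases F
  cases h
  rfl

/-- `E` is a union of cylinders that fix the places from `n` on. -/
def Saturated (n : ℤ) (E : Set X) : Prop := ∀ x ∈ E, ∀ y, κ.ray n y = κ.ray n x → y ∈ E

theorem Saturated.mono {κ : Coding X G} {n m : ℤ} {E : Set X} (h : κ.Saturated n E) (hm : m ≤ n) :
    κ.Saturated m E := fun x hx y hy => h x hx y (κ.ray_mono hm hy)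

theorem Saturated.preimage_image {κ : Coding X G} {n : ℤ} {E : Set X} (h : κ.Saturated n E) :
    κ.ray n ⁻¹' (κ.ray n '' E) = E := by
  refine Set.Subset.antisymm ?_ (Set.subset_preimage_image _ _)
  rintro y ⟨x, hx, hxy⟩
  exact h x hx y hxy.symm

theorem exists_finite_cover (E : X.COs) (N : X → ℤ) :
    ∃ S : Finset X, (∀ x ∈ S, x ∈ E.carrier) ∧
      ∀ y ∈ E.carrier, ∃ x ∈ S, κ.ray (N x) y = κ.ray (N x) x := by
  obtain ⟨S, hS, hfin, hcov⟩ := @IsCompact.elim_finite_subcover_image X X X.stableTopology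
    E.carrier E.carrier (fun x => {y | κ.ray (N x) y = κ.ray (N x) x}) E.isCompact
    (fun x _ => κ.isOpen_cyl _ _) (fun y hy => Set.mem_biUnion hy rfl)
  refine ⟨hfin.toFinset, fun x hx => hS (hfin.mem_toFinset.1 hx), fun y hy => ?_⟩
  obtain ⟨x, hx, hxy⟩ := Set.mem_iUnion₂.1 (hcov hy)
  exact ⟨x, hfin.mem_toFinset.2 hx, hxy⟩

theorem finite_rays (E : X.COs) (n : ℤ) : (κ.ray n '' E.carrier).Finite := by
  obtain ⟨S, -, hS⟩ := κ.exists_finite_cover E fun _ => n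
  refine (S.finite_toSet.image (κ.ray n)).subset ?_
  rintro _ ⟨y, hy, rfl⟩
  obtain ⟨x, hx, hxy⟩ := hS y hy
  exact ⟨x, hx, hxy.symm⟩

theorem exists_saturated (E : X.COs) : ∃ N : ℤ, ∀ n ≤ N, κ.Saturated n E.carrier := by
  choose! N hN using fun x (hx : x ∈ E.carrier) => κ.exists_cyl_subset E.isOpen hx
  obtain ⟨S, hSE, hS⟩ := κ.exists_finite_cover E N
  obtain ⟨L, hL⟩ : ∃ L : ℤ, ∀ x ∈ S, L ≤ N x := by
    obtain ⟨L, hL⟩ := (S.finite_toSet.image N).bddBelow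
    exact ⟨L, fun x hx => hL ⟨x, hx, rfl⟩⟩
  refine ⟨L, fun n hn y hy z hz => ?_⟩
  obtain ⟨x, hx, hxy⟩ := hS y hy
  exact hN x (hSE x hx) z ((κ.ray_mono (hn.trans (hL x hx)) hz).trans hxy)

/-- The compact open set of the points whose rays from `n` on are in the finite set `T`. -/
def ofRays (n : ℤ) (T : Set G.Ray) (hT : T.Finite) (hne : T.Nonempty)
    (hs : ∃ x : X, κ.ray n ⁻¹' T ⊆ X.stableSet x) : X.COs where
  carrier := κ.ray n ⁻¹' T
  nonempty := hne.preimage (κ.ray_surjective n)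
  subset_stable := hs
  isOpen := by
    have : κ.ray n ⁻¹' T = ⋃ f ∈ T, {y | κ.ray n y = f} := by ext; simp
    rw [this]
    exact @isOpen_biUnion _ _ X.stableTopology _ _ fun f _ => κ.isOpen_cyl n f
  isCompact := by
    have : κ.ray n ⁻¹' T = ⋃ f ∈ T, {y | κ.ray n y = f} := by ext; simp
    rw [this]
    exact @Set.Finite.isCompact_biUnion _ _ X.stableTopology _ _ hT fun f _ => κ.isCompact_cyl n f

/-- The set of the points whose ray from `n` on is `f`. -/
def cyl (n : ℤ) (f : G.Ray) : X.COs := κ.ofRays n {f} (Set.finite_singleton f)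
  (Set.singleton_nonempty f) (by
    obtain ⟨x, hx⟩ := κ.ray_surjective n f
    exact ⟨x, fun y hy => κ.mem_stableSet.2 ⟨n, (Set.mem_singleton_iff.1 hy).trans hx.symm⟩⟩)

theorem mem_cyl {n : ℤ} {f : G.Ray} {x : X} : x ∈ (κ.cyl n f).carrier ↔ κ.ray n x = f := Iff.rfl

theorem saturated_cyl (n : ℤ) (f : G.Ray) : κ.Saturated n (κ.cyl n f).carrier :=
  fun _ hx _ hy => hy.trans hx

/-- The class of a cylinder. -/
def rcls (n : ℤ) (f : G.Ray) : X.Ds := X.clsS (κ.cyl n f)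

theorem clsS_eq_of_equiv {E F : X.COs} (h : SmaleSpace.COs.Equiv X E F) : X.clsS E = X.clsS F :=
  (QuotientAddGroup.eq_iff_sub_mem).2 (AddSubgroup.subset_closure (Or.inl ⟨E, F, h, rfl⟩))

theorem clsS_union {E F K : X.COs} (h : Disjoint E.carrier F.carrier)
    (hK : K.carrier = E.carrier ∪ F.carrier) : X.clsS K = X.clsS E + X.clsS F := by
  refine (QuotientAddGroup.eq_iff_sub_mem (N := X.relS) (x := FreeAbelianGroup.of K)
    (y := FreeAbelianGroup.of E + FreeAbelianGroup.of F)).2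
      (AddSubgroup.subset_closure (Or.inr ⟨E, F, K, h, hK, ?_⟩))
  abel

theorem clsS_eq_sum (n : ℤ) (T : Finset G.Ray) (hT : T.Nonempty) :
    ∀ E : X.COs, E.carrier = κ.ray n ⁻¹' T → X.clsS E = ∑ f ∈ T, κ.rcls n f := by
  induction hT using Finset.Nonempty.cons_induction with
  | singleton f =>
    intro E hE
    rw [Finset.sum_singleton, rcls, COs_ext (E := E) (F := κ.cyl n f)]
    rw [hE, Finset.coe_singleton]
    rfl
  | cons f T hf hT ih =>
    intro E hE
    rw [Finset.coe_cons] at hE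
    obtain ⟨x, hx⟩ := E.subset_stable
    let F := κ.ofRays n T T.finite_toSet hT
      ⟨x, fun y hy => hx (hE ▸ Or.inr hy)⟩
    rw [Finset.sum_cons, ← ih F rfl]
    refine clsS_union (Set.disjoint_left.2 fun y hy hyT => hf ?_) ?_
    · exact (κ.mem_cyl.1 hy) ▸ hyT
    · rw [hE, Set.insert_eq, Set.preimage_union]
      rfl

theorem clsS_eq_sum_rays {n : ℤ} {E : X.COs} (h : κ.Saturated n E.carrier) :
    X.clsS E = ∑ f ∈ (κ.finite_rays E n).toFinset, κ.rcls n f := by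
  refine κ.clsS_eq_sum n _ ?_ E ?_
  · exact (Set.Finite.toFinset_nonempty _).2 (E.nonempty.image _)
  · rw [Set.Finite.coe_toFinset, h.preimage_image]

end Coding

/-! ### Counting rays by initial vertex -/

namespace FinGraph

variable {G : FinGraph.{u}}

noncomputable instance : Fintype G.E := Fintype.ofFinite _

/-- The ray `f₁ f₂ …`. -/
def Ray.tl (f : G.Ray) : G.Ray where
  edge k := f.edge (k + 1)
  chain k := f.chain (k + 1)

theorem Ray.tl_start (f : G.Ray) : f.tl.start = G.t (f.edge 0) := (f.chain 0).symm

theorem Ray.ext_tl {f g : G.Ray} (h0 : f.edge 0 = g.edge 0) (h : f.tl = g.tl) : f = g :=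
  Ray.ext fun k => by
    cases k with
    | zero => exact h0
    | succ k => exact congrArg (fun r : G.Ray => r.edge k) h

theorem Path.ray_tl (x : G.Path) (n : ℤ) : (x.ray (n - 1)).tl = x.ray n := by
  refine Ray.ext fun k => ?_
  change x (n - 1 + ((k + 1 : ℕ) : ℤ)) = x (n + k)
  exact congrArg x.edge (by push_cast; ring)

theorem adjZ_apply (v w : G.V) :
    G.adjZ v w = ((Finset.univ.filter fun e => G.i e = v ∧ G.t e = w).card : ℤ) := by
  rw [← Fintype.card_subtype, ← Nat.card_eq_fintype_card]
  rfl

/-- The number of rays in `T` that start at a given vertex. -/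
def countVec (T : Finset G.Ray) : G.V → ℤ := fun v => ((T.filter fun f => f.start = v).card : ℤ)

theorem sum_start {N : Type*} [AddCommGroup N] (T : Finset G.Ray) (h : G.V → N) :
    ∑ f ∈ T, h f.start = ∑ v, countVec T v • h v := by
  rw [← Finset.sum_fiberwise T (fun f : G.Ray => f.start)]
  refine Finset.sum_congr rfl fun v _ => ?_
  rw [Finset.sum_congr rfl fun f hf => congrArg h (Finset.mem_filter.1 hf).2, Finset.sum_const,
    countVec, natCast_zsmul]

end FinGraph

namespace DimGroup

variable {n : Type u} [Fintype n] [DecidableEq n]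

theorem mk_succ (A : Matrix n n ℤ) (v : n → ℤ) (j : ℕ) :
    DimGroup.mk A (A.mulVec v) (j + 1) = DimGroup.mk A v j := by
  have := Module.DirectLimit.of_f (R := ℤ) (ι := ℕ) (G := fun _ : ℕ => n → ℤ)
    (f := fun i j (_ : i ≤ j) => (A ^ (j - i)).mulVecLin) (hij := Nat.le_succ j) (x := v)
  simpa [DimGroup.mk] using this

end DimGroup

/-! ### From the inductive limit to `D^s` -/

namespace Coding

variable {X : SmaleSpace.{u}} {G : FinGraph.{u}} (κ : Coding X G)

theorem ray_start (n : ℤ) (x : X) : (κ.ray n x).start = G.i (κ.c x n) := Path.ray_start _ _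

theorem exists_prefix (n : ℤ) (x : X) (e : G.E) (h : G.t e = (κ.ray n x).start) :
    ∃ y, κ.ray n y = κ.ray n x ∧ κ.c y (n - 1) = e := by
  obtain ⟨y, hy⟩ := κ.ray_surjective (n - 1) (Ray.cons e _ h)
  obtain ⟨h1, h2⟩ := (Path.ray_pred _ _ _ _ _).1 hy
  exact ⟨y, h2, h1⟩

theorem image_cyl (n : ℤ) (f : G.Ray) :
    (κ.cyl (n - 1) f).carrier = X.φ '' (κ.cyl n f).carrier := by
  ext y
  rw [mem_cyl]
  constructor
  · intro hy
    refine ⟨X.φ.symm y, ?_, X.φ.apply_symm_apply y⟩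
    have := κ.ray_φ (n - 1) (X.φ.symm y)
    rw [X.φ.apply_symm_apply, sub_add_cancel] at this
    rw [mem_cyl, ← this, hy]
  · rintro ⟨x, hx, rfl⟩
    rw [ray_φ, sub_add_cancel]
    exact hx

/-- The rays share the edges at the places `-1, 0, 1`. So the points are close enough for the
bracket, and exchanging pasts up to place `0` does not leave the cylinders. -/
theorem bracket_cyl {f g : G.Ray} (h : ∀ k ≤ 2, f.edge k = g.edge k) :
    Set.image2 X.bracket (κ.cyl (-1) f).carrier (κ.cyl (-1) g).carrier =
      (κ.cyl (-1) f).carrier := by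
  have key : ∀ x ∈ (κ.cyl (-1) f).carrier, ∀ y ∈ (κ.cyl (-1) g).carrier, dist x y ≤ 1 / 2 := by
    intro x hx y hy
    refine (κ.dist_le_half x y).2 fun k h1 h2 => ?_
    have hk : k = -1 + ((k + 1).toNat : ℤ) := by omega
    rw [hk, Path.ray_eq_iff.1 hx, Path.ray_eq_iff.1 hy]
    exact h _ (by omega)
  ext z
  constructor
  · rintro ⟨x, hx, y, hy, rfl⟩
    refine Path.ray_eq_iff.2 fun k => ?_
    rw [κ.c_bracket _ _ (key x hx y hy)]
    split_ifs with hk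
    · rw [Path.ray_eq_iff.1 hy, h _ (by omega)]
    · rw [Path.ray_eq_iff.1 hx]
  · intro hz
    obtain ⟨y, hy⟩ := κ.ray_surjective (-1) g
    have hb := κ.c_bracket y z (by rw [dist_comm]; exact key z hz y hy)
    have hy' : X.bracket y z ∈ (κ.cyl (-1) g).carrier := by
      refine Path.ray_eq_iff.2 fun k => ?_
      rw [hb]
      split_ifs with hk
      · rw [Path.ray_eq_iff.1 hz, h _ (by omega)]
      · exact Path.ray_eq_iff.1 hy k
    refine ⟨z, hz, _, hy', κ.c.injective (FinGraph.Path.ext fun k => ?_)⟩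
    rw [κ.c_bracket _ _ (key z hz _ hy'), hb]
    split_ifs <;> rfl

/-- For `n = -1` the bracket relation applies directly: a cylinder from `-1` on fixes the window
`-1, …, 2`, so its diameter is at most `1 / 4` and it lies in a local stable set. Other `n` follow
because `φ` shifts cylinders and the relation is invariant under `φ` both ways. -/
theorem cyl_equiv {f g : G.Ray} (h : ∀ k ≤ 2, f.edge k = g.edge k) (n : ℤ) :
    SmaleSpace.COs.Equiv X (κ.cyl n f) (κ.cyl n g) := by
  have hloc : ∀ f : G.Ray, ∃ x, (κ.cyl (-1) f).carrier ⊆ X.localStable x X.ε := by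
    intro f
    obtain ⟨x, hx⟩ := κ.ray_surjective (-1) f
    refine ⟨x, fun y hy => (κ.mem_localStable κ.eps.le).2 ⟨?_, ?_⟩⟩
    · rw [κ.eps]
      refine lt_of_le_of_lt ((κ.dist_le_iff x y 2).2 fun k h1 h2 => ?_) (by norm_num)
      exact κ.ray_eq_iff.1 (hx.trans (κ.mem_cyl.1 hy).symm) k (by push_cast at h1; omega)
    · exact κ.ray_mono (by norm_num) ((κ.mem_cyl.1 hy).trans hx.symm)
  have base : SmaleSpace.COs.Equiv X (κ.cyl (-1) f) (κ.cyl (-1) g) := by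
    refine .bracket _ _ (hloc f) (hloc g) ?_ (κ.bracket_cyl h)
      (κ.bracket_cyl fun k hk => (h k hk).symm)
    intro x hx y hy
    rw [κ.eps]
    refine (κ.dist_le_half x y).2 fun k h1 h2 => ?_
    have hk : k = -1 + ((k + 1).toNat : ℤ) := by omega
    rw [hk, Path.ray_eq_iff.1 hx, Path.ray_eq_iff.1 hy]
    exact h _ (by omega)
  induction n using Int.inductionOn' (b := -1) with
  | zero => exact base
  | succ k _ ih =>
    refine .preimage _ _ _ _ ?_ ?_ ih
    · simpa using κ.image_cyl (k + 1) f
    · simpa using κ.image_cyl (k + 1) g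
  | pred k _ ih => exact .image _ _ _ _ (κ.image_cyl k f) (κ.image_cyl k g) ih

/-- The cylinder splits disjointly according to the edge at place `n - 1`. -/
theorem rcls_eq_sum_cons (n : ℤ) (f : G.Ray) :
    κ.rcls n f = ∑ e : {e // G.t e = f.start}, κ.rcls (n - 1) (Ray.cons e.1 f e.2) := by
  classical
  have hinj : Function.Injective fun e : {e // G.t e = f.start} => Ray.cons e.1 f e.2 :=
    fun e e' h => Subtype.ext (congrArg (fun r : G.Ray => r.edge 0) h)
  rw [rcls, κ.clsS_eq_sum (n - 1) (Finset.univ.image fun e : {e // G.t e = f.start} =>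
    Ray.cons e.1 f e.2), Finset.sum_image fun _ _ _ _ h => hinj h]
  · obtain ⟨e, he⟩ := G.no_sources f.start
    exact ⟨_, Finset.mem_image_of_mem _ (Finset.mem_univ ⟨e, he⟩)⟩
  · ext x
    simp only [Set.mem_preimage, Finset.coe_image, Finset.coe_univ, Set.image_univ, Set.mem_range]
    constructor
    · intro hx
      have hx' : (κ.c x).ray n = f := hx
      have he : G.t (κ.c x (n - 1)) = f.start := by
        rw [← hx', Path.ray_start, (κ.c x).chain, sub_add_cancel]
      exact ⟨⟨_, he⟩, ((Path.ray_pred _ _ _ _ he).2 ⟨rfl, hx⟩).symm⟩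
    · rintro ⟨e, he⟩
      exact ((Path.ray_pred _ _ _ _ e.2).1 he.symm).2

theorem rcls_eq_of_start_eq {f g : G.Ray} (h : f.start = g.start) (n : ℤ) :
    κ.rcls n f = κ.rcls n g := by
  have key : ∀ m ≤ 3, ∀ f g : G.Ray, f.start = g.start → (∀ k < 3 - m, f.edge k = g.edge k) →
      ∀ n, κ.rcls n f = κ.rcls n g := by
    intro m
    induction m with
    | zero =>
      intro _ f g _ hk n
      exact clsS_eq_of_equiv (κ.cyl_equiv (fun k h => hk k (by omega)) n)
    | succ m ih =>
      intro hm f g h0 hk n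
      rw [rcls_eq_sum_cons, rcls_eq_sum_cons]
      refine Fintype.sum_equiv (Equiv.subtypeEquivRight fun e => by rw [h0]) _ _ fun e => ?_
      change κ.rcls (n - 1) (Ray.cons e.1 f e.2) = κ.rcls (n - 1) (Ray.cons e.1 g (e.2.trans h0))
      refine ih (by omega) (Ray.cons e.1 f e.2) (Ray.cons e.1 g (e.2.trans h0)) rfl
        (fun k hk' => ?_) _
      cases k with
      | zero => rfl
      | succ k => exact hk k (by omega)
  exact key 3 le_rfl f g h (fun k hk => by omega) n

/-- The class of the cylinders that fix the places from `n` on and whose ray starts at `v`. -/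
noncomputable def vcls (n : ℤ) (v : G.V) : X.Ds := κ.rcls n (Ray.exists_start v).choose

theorem rcls_eq_vcls (n : ℤ) (f : G.Ray) : κ.rcls n f = κ.vcls n f.start :=
  κ.rcls_eq_of_start_eq (Ray.exists_start f.start).choose_spec.symm n

/-- Sorting the preceding edges by their initial vertex produces a column of `A_G`. This is the
compatibility that defines a map out of the inductive limit. -/
theorem vcls_eq_sum (n : ℤ) (w : G.V) :
    κ.vcls n w = ∑ v, G.adjZ v w • κ.vcls (n - 1) v := by
  obtain ⟨f, rfl⟩ := Ray.exists_start w
  rw [← rcls_eq_vcls, rcls_eq_sum_cons]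
  simp only [rcls_eq_vcls, Ray.cons_start]
  rw [← Finset.sum_subtype (Finset.univ.filter fun e => G.t e = f.start) (by simp)
    fun e => κ.vcls (n - 1) (G.i e),
    ← Finset.sum_fiberwise _ (fun e : G.E => G.i e)]
  refine Finset.sum_congr rfl fun v _ => ?_
  rw [Finset.sum_congr rfl fun e he => congrArg (κ.vcls (n - 1)) (Finset.mem_filter.1 he).2,
    Finset.sum_const, adjZ_apply, natCast_zsmul, Finset.filter_filter]
  simp only [and_comm]

/-- The homomorphism on the `j`-th group of the inductive limit. -/
noncomputable def level (n : ℤ) : (G.V → ℤ) →ₗ[ℤ] X.Ds := Fintype.linearCombination ℤ (κ.vcls n)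

theorem level_apply (n : ℤ) (a : G.V → ℤ) : κ.level n a = ∑ v, a v • κ.vcls n v :=
  Fintype.linearCombination_apply ..

theorem level_mulVec (n : ℤ) (a : G.V → ℤ) :
    κ.level (n - 1) (G.adjZ.mulVec a) = κ.level n a := by
  simp only [level_apply, Matrix.mulVec, dotProduct, Finset.sum_smul]
  rw [Finset.sum_comm]
  refine Finset.sum_congr rfl fun w _ => ?_
  rw [vcls_eq_sum, Finset.smul_sum]
  refine Finset.sum_congr rfl fun v _ => ?_
  rw [smul_smul, mul_comm]

theorem level_pow (k : ℕ) (n : ℤ) (a : G.V → ℤ) :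
    κ.level (n - k) ((G.adjZ ^ k).mulVec a) = κ.level n a := by
  induction k with
  | zero => simp
  | succ k ih =>
    rw [pow_succ', ← Matrix.mulVec_mulVec, ← ih, ← κ.level_mulVec (n - k)]
    push_cast
    rw [sub_sub]

/-- The homomorphism from the inductive limit to the group generated by compact open sets. -/
noncomputable def toDs : G.DimS →ₗ[ℤ] X.Ds :=
  Module.DirectLimit.lift ℤ ℕ (fun _ : ℕ => G.V → ℤ)
    (fun i j (_ : i ≤ j) => (G.adjZ ^ (j - i)).mulVecLin) (fun j => κ.level (1 - j))
    fun i j hij a => by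
      rw [Matrix.mulVecLin_apply, ← κ.level_pow (j - i) (1 - i) a]
      congr 2
      omega

theorem toDs_mk (a : G.V → ℤ) (j : ℕ) :
    κ.toDs (DimGroup.mk G.adjZ a j) = κ.level (1 - j) a :=
  Module.DirectLimit.lift_of ..

/-! ### From `D^s` to the inductive limit -/

/-- The rays from the place `n` on of the points of `E`. -/
noncomputable def rays (n : ℤ) (E : X.COs) : Finset G.Ray := (κ.finite_rays E n).toFinset

theorem mem_rays {n : ℤ} {E : X.COs} {f : G.Ray} :
    f ∈ κ.rays n E ↔ ∃ x ∈ E.carrier, κ.ray n x = f :=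
  (Set.Finite.mem_toFinset _)

theorem sum_rcls (n : ℤ) (T : Finset G.Ray) : ∑ f ∈ T, κ.rcls n f = κ.level n (countVec T) := by
  simp only [rcls_eq_vcls]
  rw [sum_start, level_apply]

theorem toDs_countVec (E : X.COs) (j : ℕ) (h : κ.Saturated (1 - j) E.carrier) :
    κ.toDs (DimGroup.mk G.adjZ (countVec (κ.rays (1 - j) E)) j) = X.clsS E := by
  rw [toDs_mk, κ.clsS_eq_sum_rays h, ← sum_rcls]
  rfl

/-- A ray from `n - 1` on is a ray from `n` on preceded by an edge that ends at its start;
saturation ensures that every such edge occurs in `E`. -/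
theorem countVec_pred {n : ℤ} {E : X.COs} (h : κ.Saturated n E.carrier) :
    countVec (κ.rays (n - 1) E) = G.adjZ.mulVec (countVec (κ.rays n E)) := by
  funext v
  have h1 := sum_start (κ.rays n E) fun w => G.adjZ v w
  simp only [smul_eq_mul] at h1
  simp only [Matrix.mulVec, dotProduct]
  rw [Finset.sum_congr rfl fun w _ => mul_comm _ _, ← h1, countVec]
  simp only [adjZ_apply]
  rw [← Nat.cast_sum, ← Finset.card_sigma, Nat.cast_inj]
  refine Finset.card_bij (fun r _ => ⟨r.tl, r.edge 0⟩) ?_ ?_ ?_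
  · intro r hr
    obtain ⟨hr, hv⟩ := Finset.mem_filter.1 hr
    obtain ⟨x, hx, rfl⟩ := κ.mem_rays.1 hr
    refine Finset.mem_sigma.2 ⟨κ.mem_rays.2 ⟨x, hx, (Path.ray_tl _ _).symm⟩, ?_⟩
    exact Finset.mem_filter.2 ⟨Finset.mem_univ _, hv, (Ray.tl_start (κ.ray (n - 1) x)).symm⟩
  · intro r _ r' _ hrr
    obtain ⟨h1, h2⟩ := Sigma.mk.inj hrr
    exact Ray.ext_tl (eq_of_heq h2) h1
  · rintro ⟨f, e⟩ hf
    obtain ⟨hf, he⟩ := Finset.mem_sigma.1 hf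
    obtain ⟨x, hx, rfl⟩ := κ.mem_rays.1 hf
    obtain ⟨-, hv, ht⟩ := Finset.mem_filter.1 he
    obtain ⟨y, hy, hye⟩ := κ.exists_prefix n x e ht
    have h0 : (κ.ray (n - 1) y).edge 0 = e := by
      rw [← hye, ray, Path.ray_edge, Nat.cast_zero, add_zero]
    refine ⟨κ.ray (n - 1) y, Finset.mem_filter.2 ⟨κ.mem_rays.2 ⟨y, h x hx y hy, rfl⟩, ?_⟩, ?_⟩
    · rw [Ray.start, h0]
      exact hv
    · have h1 : (κ.ray (n - 1) y).tl = κ.ray n x := (Path.ray_tl _ _).trans hy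
      rw [h0, h1]

theorem mk_countVec_add (E : X.COs) (j k : ℕ) (h : κ.Saturated (1 - j) E.carrier) :
    DimGroup.mk G.adjZ (countVec (κ.rays (1 - (j + k : ℕ)) E)) (j + k) =
      DimGroup.mk G.adjZ (countVec (κ.rays (1 - j) E)) j := by
  induction k with
  | zero => rfl
  | succ k ih =>
    rw [← ih, ← DimGroup.mk_succ _ (countVec (κ.rays (1 - ((j + k : ℕ) : ℤ)) E)),
      ← κ.countVec_pred (h.mono (by omega))]
    rw [show 1 - ((j + (k + 1) : ℕ) : ℤ) = 1 - ((j + k : ℕ) : ℤ) - 1 by push_cast; ring]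
    rfl

theorem mk_countVec_eq (E : X.COs) (j k : ℕ) (hj : κ.Saturated (1 - j) E.carrier)
    (hk : κ.Saturated (1 - k) E.carrier) :
    DimGroup.mk G.adjZ (countVec (κ.rays (1 - j) E)) j =
      DimGroup.mk G.adjZ (countVec (κ.rays (1 - k) E)) k := by
  rw [← κ.mk_countVec_add E j k hj, ← κ.mk_countVec_add E k j hk, add_comm]

theorem exists_saturated_nat (E : X.COs) (N : ℤ) :
    ∃ j : ℕ, 1 - (j : ℤ) ≤ N ∧ κ.Saturated (1 - j) E.carrier := by
  obtain ⟨L, hL⟩ := κ.exists_saturated E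
  exact ⟨(1 - min N L).toNat, by omega, hL _ (by omega)⟩

theorem rays_image (n : ℤ) {E E' : X.COs} (h : E'.carrier = X.φ '' E.carrier) :
    κ.rays n E' = κ.rays (n + 1) E := by
  ext f
  simp only [mem_rays, h, Set.exists_mem_image, ray_φ]

/-- Send a ray of `E` to the ray of a point of `F` with the same past up to place `0`. As `n ≤ 0`,
the initial vertex is kept. All points of `E` share the future from place `1` on, so a ray of `E` is
determined by its edges up to place `0`, and the map is injective. -/
theorem card_le_of_past_subset {n : ℤ} (hn : n ≤ 0) {E F : X.COs} {x : X}
    (hE : E.carrier ⊆ X.localStable x X.ε)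
    (hEF : ∀ x ∈ E.carrier, ∃ y ∈ F.carrier, ∀ k ≤ 0, κ.c x k = κ.c y k) (v : G.V) :
    countVec (κ.rays n E) v ≤ countVec (κ.rays n F) v := by
  have : Nonempty X := ⟨x⟩
  choose! s hsF hs using hEF
  have hex : ∀ f ∈ κ.rays n E, ∃ x ∈ E.carrier, κ.ray n x = f := fun f hf => κ.mem_rays.1 hf
  choose! p hpE hp using hex
  refine Nat.cast_le.2 (Finset.card_le_card_of_injOn (fun f => κ.ray n (s (p f))) ?_ ?_)
  · intro f hf
    obtain ⟨hf, hv⟩ := Finset.mem_filter.1 hf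
    refine Finset.mem_filter.2 ⟨κ.mem_rays.2 ⟨_, hsF _ (hpE _ hf), rfl⟩, ?_⟩
    rw [← hp f hf, ray_start] at hv
    rw [ray_start, ← hs _ (hpE _ hf) n hn, hv]
  · intro f hf g hg hfg
    have hf := (Finset.mem_filter.1 hf).1
    have hg := (Finset.mem_filter.1 hg).1
    rw [← hp f hf, ← hp g hg]
    refine κ.ray_eq_iff.2 fun k hk => ?_
    rcases le_or_gt k 0 with h | h
    · rw [hs _ (hpE _ hf) k h, hs _ (hpE _ hg) k h]
      exact κ.ray_eq_iff.1 hfg k hk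
    · have h1 := ((κ.mem_localStable κ.eps.le).1 (hE (hpE _ hf))).2
      have h2 := ((κ.mem_localStable κ.eps.le).1 (hE (hpE _ hg))).2
      exact κ.ray_eq_iff.1 (h1.trans h2.symm) k h

/-- A bracket `[x, y]` takes its past from `y`, so `[E, F] = E` puts every past of `E` among those
of `F`. -/
theorem past_subset {E F : X.COs} (hdef : ∀ x ∈ E.carrier, ∀ y ∈ F.carrier, dist x y ≤ X.ε)
    (hE : Set.image2 X.bracket E.carrier F.carrier = E.carrier) :
    ∀ x ∈ E.carrier, ∃ y ∈ F.carrier, ∀ k ≤ 0, κ.c x k = κ.c y k := by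
  intro z hz
  rw [← hE] at hz
  obtain ⟨x, hx, y, hy, rfl⟩ := hz
  refine ⟨y, hy, fun k hk => ?_⟩
  rw [κ.c_bracket _ _ ((hdef x hx y hy).trans κ.eps.le), if_pos hk]

/-- The counts agree only far enough to the left: `φ` moves the threshold by one, and the bracket
relation gives inequalities both ways for `n ≤ 0`. -/
theorem countVec_eq_of_equiv {E F : X.COs} (h : SmaleSpace.COs.Equiv X E F) :
    ∃ N : ℤ, ∀ n ≤ N, countVec (κ.rays n E) = countVec (κ.rays n F) := by
  induction h with
  | bracket E F hEloc hFloc hdef hE hF =>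
    obtain ⟨x, hx⟩ := hEloc
    obtain ⟨y, hy⟩ := hFloc
    refine ⟨0, fun n hn => funext fun v => le_antisymm ?_ ?_⟩
    · exact κ.card_le_of_past_subset hn hx (κ.past_subset hdef hE) v
    · exact κ.card_le_of_past_subset hn hy
        (κ.past_subset (fun x hx y hy => by rw [dist_comm]; exact hdef y hy x hx) hF) v
  | image E F E' F' hE hF _ ih =>
    obtain ⟨N, hN⟩ := ih
    refine ⟨N - 1, fun n hn => ?_⟩
    rw [κ.rays_image n hE, κ.rays_image n hF]
    exact hN _ (by omega)
  | preimage E F E' F' hE hF _ ih =>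
    obtain ⟨N, hN⟩ := ih
    refine ⟨N + 1, fun n hn => ?_⟩
    have := hN (n - 1) (by omega)
    rwa [κ.rays_image _ hE, κ.rays_image _ hF, sub_add_cancel] at this
  | refl E => exact ⟨0, fun n _ => rfl⟩
  | symm E F _ ih => exact ih.imp fun N hN n hn => (hN n hn).symm
  | trans E F K _ _ ih1 ih2 =>
    obtain ⟨N, hN⟩ := ih1
    obtain ⟨L, hL⟩ := ih2
    exact ⟨min N L, fun n hn => (hN n (by omega)).trans (hL n (by omega))⟩

/-- The class of a compact open set in the inductive limit. -/
noncomputable def dimCls (E : X.COs) : G.DimS :=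
  DimGroup.mk G.adjZ (countVec (κ.rays (1 - ((κ.exists_saturated_nat E 0).choose : ℤ)) E))
    (κ.exists_saturated_nat E 0).choose

theorem dimCls_eq {E : X.COs} {j : ℕ} (h : κ.Saturated (1 - j) E.carrier) :
    κ.dimCls E = DimGroup.mk G.adjZ (countVec (κ.rays (1 - j) E)) j :=
  κ.mk_countVec_eq E _ j (κ.exists_saturated_nat E 0).choose_spec.2 h

theorem dimCls_eq_of_equiv {E F : X.COs} (h : SmaleSpace.COs.Equiv X E F) :
    κ.dimCls E = κ.dimCls F := by
  obtain ⟨N, hN⟩ := κ.countVec_eq_of_equiv h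
  obtain ⟨j, hj, hE⟩ := κ.exists_saturated_nat E N
  obtain ⟨k, hk, hF⟩ := κ.exists_saturated_nat F N
  have h1 := hE.mono (m := 1 - (j + k : ℕ)) (by omega)
  have h2 := hF.mono (m := 1 - (j + k : ℕ)) (by omega)
  rw [κ.dimCls_eq h1, κ.dimCls_eq h2, hN _ (by omega)]

theorem dimCls_union {E F K : X.COs} (h : Disjoint E.carrier F.carrier)
    (hK : K.carrier = E.carrier ∪ F.carrier) : κ.dimCls K = κ.dimCls E + κ.dimCls F := by
  classical
  obtain ⟨j, hj, hE⟩ := κ.exists_saturated_nat E 0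
  obtain ⟨k, hk, hF⟩ := κ.exists_saturated_nat F 0
  have h1 := hE.mono (m := 1 - (j + k : ℕ)) (by omega)
  have h2 := hF.mono (m := 1 - (j + k : ℕ)) (by omega)
  have h3 : κ.Saturated (1 - (j + k : ℕ)) K.carrier := by
    rw [hK]
    rintro x (hx | hx) y hy
    · exact Or.inl (h1 x hx y hy)
    · exact Or.inr (h2 x hx y hy)
  rw [κ.dimCls_eq h1, κ.dimCls_eq h2, κ.dimCls_eq h3, DimGroup.mk, DimGroup.mk, DimGroup.mk,
    ← map_add]
  congr 1
  generalize (1 - ((j + k : ℕ) : ℤ)) = n at *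
  have hu : κ.rays n K = κ.rays n E ∪ κ.rays n F := by
    ext f
    simp only [Finset.mem_union, mem_rays, hK, Set.mem_union, or_and_right, exists_or]
  -- Disjoint sets could share rays in general; saturation at level `n` excludes it.
  have hd : Disjoint (κ.rays n E) (κ.rays n F) := by
    refine Finset.disjoint_left.2 fun f hf hf' => ?_
    obtain ⟨x, hx, rfl⟩ := κ.mem_rays.1 hf
    obtain ⟨y, hy, hxy⟩ := κ.mem_rays.1 hf'
    exact Set.disjoint_left.1 h hx (h2 y hy x hxy.symm)
  funext v
  rw [Pi.add_apply, countVec, hu, Finset.filter_union,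
    Finset.card_union_of_disjoint (Finset.disjoint_filter_filter hd), Nat.cast_add]
  rfl

/-- The homomorphism from the group generated by compact open sets to the inductive limit. -/
noncomputable def ofDs : X.Ds →+ G.DimS :=
  QuotientAddGroup.lift X.relS (FreeAbelianGroup.lift κ.dimCls) <| by
    rw [SmaleSpace.relS, AddSubgroup.closure_le]
    rintro a (⟨E, F, h, rfl⟩ | ⟨E, F, K, h, hK, rfl⟩)
    · simp [κ.dimCls_eq_of_equiv h]
    · simp [κ.dimCls_union h hK]

theorem ofDs_clsS (E : X.COs) : κ.ofDs (X.clsS E) = κ.dimCls E := by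
  rw [ofDs, SmaleSpace.clsS, QuotientAddGroup.lift_mk, FreeAbelianGroup.lift_apply_of]

theorem toDs_ofDs (a : X.Ds) : κ.toDs (κ.ofDs a) = a := by
  have : κ.toDs.toAddMonoidHom.comp κ.ofDs = AddMonoidHom.id _ := by
    refine QuotientAddGroup.addMonoidHom_ext _ (FreeAbelianGroup.lift_ext _ _ fun E => ?_)
    obtain ⟨j, -, hj⟩ := κ.exists_saturated_nat E 0
    change κ.toDs (κ.ofDs (X.clsS E)) = X.clsS E
    rw [ofDs_clsS, κ.dimCls_eq hj, κ.toDs_countVec E j hj]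
  exact DFunLike.congr_fun this a

theorem level_single (n : ℤ) (v : G.V) : κ.level n (Pi.single v 1) = κ.vcls n v := by
  rw [level_apply, Finset.sum_eq_single v (fun w _ hw => by simp [hw]) (by simp)]
  simp

theorem countVec_cyl (n : ℤ) (f : G.Ray) :
    countVec (κ.rays n (κ.cyl n f)) = Pi.single f.start 1 := by
  have : κ.rays n (κ.cyl n f) = {f} := by
    ext g
    rw [mem_rays, Finset.mem_singleton]
    constructor
    · rintro ⟨x, hx, rfl⟩
      exact hx
    · rintro rfl
      exact (κ.ray_surjective n g).imp fun x hx => ⟨hx, hx⟩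
  funext v
  rw [countVec, this, Finset.filter_singleton]
  by_cases h : f.start = v
  · subst h
    simp
  · simp [h, Ne.symm h]

/-- It suffices to test basis vectors. The image of `[δ_v, j]` is the class of a cylinder, whose
only ray from `1 - j` on starts at `v`. -/
theorem ofDs_toDs (a : G.DimS) : κ.ofDs (κ.toDs a) = a := by
  induction a using Module.DirectLimit.induction_on with
  | _ j a =>
    change κ.ofDs (κ.toDs (DimGroup.mk G.adjZ a j)) = DimGroup.mk G.adjZ a j
    have : κ.ofDs.toIntLinearMap.comp (κ.toDs.comp (Module.DirectLimit.of ℤ ℕ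
        (fun _ : ℕ => G.V → ℤ) (fun i j (_ : i ≤ j) => (G.adjZ ^ (j - i)).mulVecLin) j)) =
        Module.DirectLimit.of ℤ ℕ (fun _ : ℕ => G.V → ℤ)
          (fun i j (_ : i ≤ j) => (G.adjZ ^ (j - i)).mulVecLin) j := by
      refine LinearMap.pi_ext' fun v => LinearMap.ext_ring ?_
      change κ.ofDs (κ.toDs (DimGroup.mk G.adjZ (Pi.single v 1) j)) =
        DimGroup.mk G.adjZ (Pi.single v 1) j
      obtain ⟨f, rfl⟩ := Ray.exists_start v
      rw [toDs_mk, level_single, ← rcls_eq_vcls, rcls, ofDs_clsS,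
        κ.dimCls_eq (κ.saturated_cyl _ f), countVec_cyl]
    exact LinearMap.congr_fun this a

/-- The identification of the inductive limit with the group generated by compact open sets. -/
noncomputable def ident : G.DimS ≃+ X.Ds where
  toFun := κ.toDs
  invFun := κ.ofDs
  left_inv := κ.ofDs_toDs
  right_inv := κ.toDs_ofDs
  map_add' := map_add κ.toDs

theorem ident_mk (a : G.V → ℤ) (j : ℕ) :
    κ.ident (DimGroup.mk G.adjZ a j) = κ.level (1 - j) a := κ.toDs_mk a j

theorem ident_single (x : X) (j : ℕ) :
    κ.ident (DimGroup.mk G.adjZ (Pi.single (G.i (κ.c x (1 - (j : ℤ)))) 1) j) =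
      X.clsS (κ.cyl (1 - j) (κ.ray (1 - j) x)) := by
  rw [ident_mk, level_single, ← Path.ray_start]
  exact (κ.rcls_eq_vcls _ _).symm

theorem ident_symm_clsS {E : X.COs} {j : ℕ} (h : κ.Saturated (1 - j) E.carrier) :
    κ.ident.symm (X.clsS E) = DimGroup.mk G.adjZ (countVec (κ.rays (1 - j) E)) j := by
  rw [AddEquiv.symm_apply_eq]
  exact (κ.toDs_countVec E j h).symm

end Coding

/-! ### Coverings of graphs and unique lifting of paths -/

/-- A homomorphism of graphs. -/
structure GraphHom (M G : FinGraph.{u}) where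
  onV : M.V → G.V
  onE : M.E → G.E
  i_onE : ∀ e, G.i (onE e) = onV (M.i e)
  t_onE : ∀ e, G.t (onE e) = onV (M.t e)

namespace GraphHom

variable {M G : FinGraph.{u}} (p : GraphHom M G)

/-- The same homomorphism between the reversed graphs. -/
abbrev rev : GraphHom M.rev G.rev where
  onV := p.onV
  onE := p.onE
  i_onE := p.t_onE
  t_onE := p.i_onE

/-- Edges lift uniquely once the lift of the initial vertex is given. -/
def RightCovering : Prop :=
  ∀ m g, G.i g = p.onV m → ∃! e, M.i e = m ∧ p.onE e = g

/-- Edges lift uniquely once the lift of the terminal vertex is given. -/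
def LeftCovering : Prop :=
  ∀ m g, G.t g = p.onV m → ∃! e, M.t e = m ∧ p.onE e = g

/-- The image of a ray. -/
def mapRay (f : M.Ray) : G.Ray where
  edge k := p.onE (f.edge k)
  chain k := by rw [p.t_onE, p.i_onE, f.chain]

theorem mapRay_start (f : M.Ray) : (p.mapRay f).start = p.onV f.start := p.i_onE _

/-- The matrix of the map of vertices. -/
def mat : Matrix M.V G.V ℤ := Matrix.of fun m v => if p.onV m = v then 1 else 0

theorem mat_mulVec (c : G.V → ℤ) (m : M.V) : p.mat.mulVec c m = c (p.onV m) := by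
  simp [mat, Matrix.mulVec, dotProduct]

theorem mat_transpose_mulVec (c : M.V → ℤ) (v : G.V) :
    p.mat.transpose.mulVec c v = ∑ m, if p.onV m = v then c m else 0 := by
  simp [mat, Matrix.mulVec, dotProduct]

variable {p}

/-- By unique lifting, the edges of `G` from `p.onV m` to `v` correspond to the edges of `M` from
`m` to the fibre over `v`. -/
theorem RightCovering.mat_mul (hp : p.RightCovering) : p.mat * G.adjZ = M.adjZ * p.mat := by
  ext m v
  have h1 : (p.mat * G.adjZ) m v = G.adjZ (p.onV m) v :=
    p.mat_mulVec (fun w => G.adjZ w v) m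
  have h2 : (M.adjZ * p.mat) m v =
      ((Finset.univ.filter fun e => M.i e = m ∧ p.onV (M.t e) = v).card : ℤ) := by
    have : ∀ m', M.adjZ m m' * p.mat m' v = (((Finset.univ.filter fun e =>
        M.i e = m ∧ p.onV (M.t e) = v).filter fun e => M.t e = m').card : ℤ) := by
      intro m'
      rw [adjZ_apply, mat, Matrix.of_apply, Finset.filter_filter]
      by_cases h : p.onV m' = v
      · rw [if_pos h, mul_one]
        congr 3
        ext e
        constructor
        · rintro ⟨h1, h2⟩
          exact ⟨⟨h1, h2 ▸ h⟩, h2⟩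
        · rintro ⟨⟨h1, _⟩, h2⟩
          exact ⟨h1, h2⟩
      · rw [if_neg h, mul_zero, Finset.filter_false_of_mem, Finset.card_empty, Nat.cast_zero]
        rintro e - ⟨⟨_, h1⟩, h2⟩
        exact h (h2 ▸ h1)
    rw [Matrix.mul_apply, Finset.sum_congr rfl fun m' _ => this m', ← Nat.cast_sum,
      ← Finset.card_eq_sum_card_fiberwise fun _ _ => Finset.mem_coe.2 (Finset.mem_univ _)]
  rw [h1, h2, adjZ_apply, Nat.cast_inj]
  symm
  refine Finset.card_bij (fun e _ => p.onE e) ?_ ?_ ?_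
  · intro e he
    obtain ⟨-, h1, h2⟩ := Finset.mem_filter.1 he
    exact Finset.mem_filter.2 ⟨Finset.mem_univ _, by rw [p.i_onE, h1], by rw [p.t_onE, h2]⟩
  · intro e he e' he' h
    obtain ⟨-, h1, -⟩ := Finset.mem_filter.1 he
    obtain ⟨-, h2, -⟩ := Finset.mem_filter.1 he'
    exact (hp m (p.onE e) (by rw [p.i_onE, h1])).unique ⟨h1, rfl⟩ ⟨h2, h.symm⟩
  · intro g hg
    obtain ⟨-, h1, h2⟩ := Finset.mem_filter.1 hg
    obtain ⟨e, ⟨he, rfl⟩, -⟩ := hp m g h1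
    exact ⟨e, Finset.mem_filter.2 ⟨Finset.mem_univ _, he, by rw [← p.t_onE, h2]⟩, rfl⟩

theorem _root_.FinGraph.adjZ_rev (G : FinGraph.{u}) : G.rev.adjZ = G.adjZ.transpose := by
  ext v w
  rw [Matrix.transpose_apply, adjZ_apply, adjZ_apply]
  simp only [and_comm]

theorem LeftCovering.transpose_mat_mul (hp : p.LeftCovering) :
    p.mat.transpose * M.adjZ = G.adjZ * p.mat.transpose := by
  have : p.rev.mat * G.rev.adjZ = M.rev.adjZ * p.rev.mat := RightCovering.mat_mul (p := p.rev) hp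
  rw [adjZ_rev, adjZ_rev] at this
  have := congrArg Matrix.transpose this
  rw [Matrix.transpose_mul, Matrix.transpose_mul, Matrix.transpose_transpose,
    Matrix.transpose_transpose] at this
  exact this.symm

theorem RightCovering.exists_ray (hp : p.RightCovering) (r : G.Ray) (m : M.V)
    (h : r.start = p.onV m) : ∃ f : M.Ray, f.start = m ∧ p.mapRay f = r := by
  have : Nonempty M.E := (M.no_sinks m).nonempty
  choose! l hl using fun m g h => (hp m g h).exists
  let s : ℕ → M.V := fun k => Nat.rec m (fun j w => M.t (l w (r.edge j))) k
  have hs : ∀ k, G.i (r.edge k) = p.onV (s k) := by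
    intro k
    induction k with
    | zero => exact h
    | succ k ih =>
      rw [← r.chain]
      change _ = p.onV (M.t (l (s k) (r.edge k)))
      rw [← p.t_onE, (hl _ _ ih).2]
  exact ⟨⟨fun k => l (s k) (r.edge k), fun k => (hl _ _ (hs (k + 1))).1.symm⟩,
    (hl _ _ (hs 0)).1, Ray.ext fun k => (hl _ _ (hs k)).2⟩

theorem RightCovering.ray_eq (hp : p.RightCovering) {f g : M.Ray} (h0 : f.start = g.start)
    (h : p.mapRay f = p.mapRay g) : f = g := by
  have hE : ∀ k, p.onE (f.edge k) = p.onE (g.edge k) := fun k =>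
    congrArg (fun r : G.Ray => r.edge k) h
  have key : ∀ k, M.i (f.edge k) = M.i (g.edge k) → f.edge k = g.edge k := fun k hk =>
    (hp _ _ (p.i_onE _)).unique ⟨rfl, rfl⟩ ⟨hk.symm, (hE k).symm⟩
  refine Ray.ext fun k => key k ?_
  induction k with
  | zero => exact h0
  | succ k ih => rw [← f.chain, ← g.chain, key k ih]

theorem LeftCovering.exists_path (hp : p.LeftCovering) {n : ℤ} {r : M.Ray} {z : G.Path}
    (h : z.ray n = p.mapRay r) : ∃ y : M.Path, y.ray n = r ∧ ∀ k, p.onE (y k) = z k := by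
  obtain ⟨y, hy, hyz⟩ := r.exists_path n (fun k m => p.onV m = G.t (z k)) (fun k e => p.onE e = z k)
    (by rw [← p.mapRay_start, ← h, Path.ray_start, z.chain, sub_add_cancel])
    (fun k m hm => by
      obtain ⟨e, ⟨h1, h2⟩, -⟩ := hp m (z k) hm.symm
      refine ⟨e, h1, h2, ?_⟩
      rw [z.chain, sub_add_cancel, ← p.i_onE, h2])
  refine ⟨y, hy, fun k => ?_⟩
  rcases lt_or_ge k n with hk | hk
  · exact hyz k hk
  · have h1 := Path.ray_eq_iff.1 hy (k - n).toNat
    have h2 := Path.ray_eq_iff.1 h (k - n).toNat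
    rw [show n + ((k - n).toNat : ℤ) = k by omega] at h1 h2
    rw [h1, h2]
    rfl

/-- Starting from the common future, unique lifting with given terminal vertex moves the agreement
one place to the left at a time. -/
theorem LeftCovering.agree (hp : p.LeftCovering) {n N : ℤ} {x y : M.Path}
    (hN : ∀ k, N ≤ k → x k = y k) (h : ∀ k, n ≤ k → p.onE (x k) = p.onE (y k)) :
    ∀ k, n ≤ k → x k = y k := by
  have key : ∀ j : ℕ, ∀ k, n ≤ k → N - j ≤ k → x k = y k := by
    intro j
    induction j with
    | zero => intro k _ hk; exact hN k (by simpa using hk)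
    | succ j ih =>
      intro k hk hkj
      have := ih (k + 1) (by omega) (by push_cast at hkj; omega)
      refine (hp _ _ (p.t_onE (x k))).unique ⟨rfl, rfl⟩ ⟨?_, (h k hk).symm⟩
      rw [x.chain, y.chain, this]
  intro k hk
  exact key (N - k).toNat k hk (by omega)

end GraphHom

namespace DimGroup

variable {l m n : Type u} [Fintype l] [DecidableEq l] [Fintype m] [DecidableEq m] [Fintype n]
  [DecidableEq n]

theorem map_map (A : Matrix n n ℤ) (B : Matrix m m ℤ) (C : Matrix l l ℤ) (F : Matrix m n ℤ)
    (F' : Matrix l m ℤ) (h : F * A = B * F) (h' : F' * B = C * F') (h'' : F' * F * A = C * (F' * F))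
    (a : DimGroup A) : map B C F' h' (map A B F h a) = map A C (F' * F) h'' a := by
  induction a using Module.DirectLimit.induction_on with
  | _ j a =>
    change map B C F' h' (map A B F h (mk A a j)) = map A C (F' * F) h'' (mk A a j)
    rw [map_mk, map_mk, map_mk, Matrix.mulVec_mulVec]

end DimGroup

/-! ### Maps given by coverings and their induced homomorphisms -/

/-- `π` is the map given by the graph homomorphism `p`. -/
def Coding.Covers {X Y : SmaleSpace.{u}} {M G : FinGraph.{u}} (κ : Coding X M) (μ : Coding Y G)
    (p : GraphHom M G) (π : SmaleMap X Y) : Prop :=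
  ∀ x k, μ.c (π.toFun x) k = p.onE (κ.c x k)

namespace Coding.Covers

variable {X Y : SmaleSpace.{u}} {M G : FinGraph.{u}} {κ : Coding X M} {μ : Coding Y G}
  {p : GraphHom M G} {π : SmaleMap X Y}

theorem ray (h : κ.Covers μ p π) (n : ℤ) (x : X) : μ.ray n (π.toFun x) = p.mapRay (κ.ray n x) :=
  Ray.ext fun _ => h x _

theorem mapsTo_stableSet (h : κ.Covers μ p π) {x y : X} (hy : y ∈ X.stableSet x) :
    π.toFun y ∈ Y.stableSet (π.toFun x) := by
  obtain ⟨n, hn⟩ := κ.mem_stableSet.1 hy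
  exact μ.mem_stableSet.2 ⟨n, by rw [h.ray, h.ray, hn]⟩

theorem exists_preimage (h : κ.Covers μ p π) (hp : p.LeftCovering) {n : ℤ} {x : X} {z : Y}
    (hz : μ.ray n z = p.mapRay (κ.ray n x)) : ∃ y, κ.ray n y = κ.ray n x ∧ π.toFun y = z := by
  obtain ⟨y, hy, hyz⟩ := hp.exists_path hz
  refine ⟨κ.c.symm y, by rw [Coding.ray, Equiv.apply_symm_apply, hy],
    μ.c.injective (FinGraph.Path.ext fun k => ?_)⟩
  rw [h, Equiv.apply_symm_apply, hyz]

theorem ray_eq (h : κ.Covers μ p π) (hp : p.LeftCovering) {n : ℤ} {x y : X}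
    (hxy : y ∈ X.stableSet x) (hn : μ.ray n (π.toFun x) = μ.ray n (π.toFun y)) :
    κ.ray n x = κ.ray n y := by
  obtain ⟨N, hN⟩ := κ.mem_stableSet.1 hxy
  refine κ.ray_eq_iff.2 (hp.agree (κ.ray_eq_iff.1 hN.symm) fun k hk => ?_)
  rw [← h, ← h, μ.ray_eq_iff.1 hn k hk]

/-- For surjectivity, a point stably equivalent to `π x` agrees with it from some `n` on; keep the
ray of `x` from there and lift the rest backwards. Injectivity is uniqueness of that lift. -/
theorem sBijective (h : κ.Covers μ p π) (hp : p.LeftCovering) : π.SBijective := by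
  refine fun x => ⟨fun y hy => h.mapsTo_stableSet hy, fun y hy z hz hyz => ?_, fun z hz => ?_⟩
  · obtain ⟨N, hN⟩ := κ.mem_stableSet.1 hy
    obtain ⟨L, hL⟩ := κ.mem_stableSet.1 hz
    have hst : z ∈ X.stableSet y := κ.mem_stableSet.2 ⟨max N L,
      (κ.ray_mono (le_max_right N L) hL).trans (κ.ray_mono (le_max_left N L) hN).symm⟩
    refine κ.c.injective (FinGraph.Path.ext fun k => ?_)
    exact κ.ray_eq_iff.1 (h.ray_eq hp (n := k) hst (by rw [hyz])) k le_rfl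
  · obtain ⟨n, hn⟩ := μ.mem_stableSet.1 hz
    rw [h.ray] at hn
    obtain ⟨y, hy, rfl⟩ := h.exists_preimage hp hn
    exact ⟨y, κ.mem_stableSet.2 ⟨n, hy⟩, rfl⟩

/-- A ray of `y` from `1 - K` on lifts forwards from any vertex over its start, and the lift extends
to a bi-infinite path whose image is within `2 ^ (-K)` of `y`. So the image is dense, and it is
compact. -/
theorem surjective (h : κ.Covers μ p π) (hp : p.RightCovering) (hs : Function.Surjective p.onV) :
    Function.Surjective π.toFun := by
  intro y
  have hcl : IsClosed (Set.range π.toFun) := (isCompact_range π.continuous).isClosed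
  refine hcl.closure_subset (Metric.mem_closure_iff.2 fun ε hε => ?_)
  obtain ⟨K, hK⟩ := exists_pow_lt_of_lt_one hε (show (1 / 2 : ℝ) < 1 by norm_num)
  obtain ⟨m, hm⟩ := hs (μ.ray (1 - K) y).start
  obtain ⟨f, -, hf⟩ := hp.exists_ray _ m hm.symm
  obtain ⟨x, rfl⟩ := κ.ray_surjective (1 - K) f
  rw [← h.ray] at hf
  exact ⟨_, ⟨x, rfl⟩, lt_of_le_of_lt ((μ.dist_le_iff _ _ _).2 fun k hk _ =>
    (μ.ray_eq_iff.1 hf k hk).symm) hK⟩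

theorem isPushS (h : κ.Covers μ p π) (hp : p.LeftCovering) :
    π.IsPushS ((μ.ident.toAddMonoidHom.comp
      (DimGroup.map M.adjZ G.adjZ p.mat.transpose hp.transpose_mat_mul)).comp
        κ.ident.symm.toAddMonoidHom) := by
  classical
  intro E
  obtain ⟨j, -, hj⟩ := κ.exists_saturated_nat E 0
  obtain ⟨x₀, hx₀⟩ := E.subset_stable
  -- Backward lifting shows that the image of a saturated set is saturated at the same level.
  have hpre : μ.ray (1 - j) ⁻¹' ((κ.rays (1 - j) E).image p.mapRay : Finset G.Ray) =
      π.toFun '' E.carrier := by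
    ext z
    simp only [Set.mem_preimage, Finset.mem_coe, Finset.mem_image, Coding.mem_rays]
    constructor
    · rintro ⟨_, ⟨x, hx, rfl⟩, hz⟩
      obtain ⟨y, hy, rfl⟩ := h.exists_preimage hp hz.symm
      exact ⟨y, hj x hx y hy, rfl⟩
    · rintro ⟨x, hx, rfl⟩
      exact ⟨_, ⟨x, hx, rfl⟩, (h.ray _ _).symm⟩
  let E' : Y.COs := μ.ofRays (1 - j) ((κ.rays (1 - j) E).image p.mapRay : Finset G.Ray)
    (Finset.finite_toSet _) (by
      obtain ⟨x, hx⟩ := E.nonempty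
      exact ⟨_, Finset.mem_coe.2 (Finset.mem_image_of_mem _ (κ.mem_rays.2 ⟨x, hx, rfl⟩))⟩)
    ⟨π.toFun x₀, by
      rw [hpre]
      rintro _ ⟨x, hx, rfl⟩
      exact h.mapsTo_stableSet (hx₀ hx)⟩
  refine ⟨E', hpre, ?_⟩
  have hsum := μ.clsS_eq_sum (1 - j) ((κ.rays (1 - j) E).image p.mapRay) (by
    obtain ⟨x, hx⟩ := E.nonempty
    exact ⟨_, Finset.mem_image_of_mem _ (κ.mem_rays.2 ⟨x, hx, rfl⟩)⟩) E' rfl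
  change μ.ident (DimGroup.map _ _ _ hp.transpose_mat_mul (κ.ident.symm (X.clsS E))) = _
  rw [κ.ident_symm_clsS hj, DimGroup.map_mk, μ.ident_mk, hsum, Coding.sum_rcls]
  congr 1
  funext v
  -- `E` lies in one stable set, so two of its rays have a common future and coincide once their
  -- images do. Hence no ray is lost in the count.
  have hinj : Set.InjOn p.mapRay (κ.rays (1 - j) E : Set M.Ray) := by
    intro f hf g hg hfg
    obtain ⟨x, hx, rfl⟩ := κ.mem_rays.1 hf
    obtain ⟨y, hy, rfl⟩ := κ.mem_rays.1 hg
    obtain ⟨N, hN⟩ := κ.mem_stableSet.1 (hx₀ hx)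
    obtain ⟨L, hL⟩ := κ.mem_stableSet.1 (hx₀ hy)
    refine h.ray_eq hp (κ.mem_stableSet.2 ⟨max N L, (κ.ray_mono (le_max_right N L) hL).trans
      (κ.ray_mono (le_max_left N L) hN).symm⟩) ?_
    rw [h.ray, h.ray, hfg]
  have h1 := sum_start (κ.rays (1 - j) E) fun m => if p.onV m = v then (1 : ℤ) else 0
  rw [p.mat_transpose_mulVec, countVec, Finset.filter_image,
    Finset.card_image_of_injOn (hinj.mono (Finset.coe_subset.2 (Finset.filter_subset _ _)))]
  simp only [smul_eq_mul, mul_ite, mul_one, mul_zero] at h1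
  rw [← h1, Finset.sum_boole]
  simp only [p.mapRay_start]

/-- Rays that agree from some place on. -/
def tailSetoid (M : FinGraph.{u}) : Setoid M.Ray where
  r f g := ∃ K, ∀ k, K ≤ k → f.edge k = g.edge k
  iseqv :=
    { refl := fun _ => ⟨0, fun _ _ => rfl⟩
      symm := fun ⟨K, hK⟩ => ⟨K, fun k hk => (hK k hk).symm⟩
      trans := fun ⟨K, hK⟩ ⟨L, hL⟩ => ⟨max K L, fun k hk =>
        (hK k (le_of_max_le_left hk)).trans (hL k (le_of_max_le_right hk))⟩ }

theorem mem_stableSet_iff_tail (κ : Coding X M) (n : ℤ) {x y : X} :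
    y ∈ X.stableSet x ↔
      Quotient.mk (tailSetoid M) (κ.ray n y) = Quotient.mk (tailSetoid M) (κ.ray n x) := by
  rw [κ.mem_stableSet, Quotient.eq]
  constructor
  · rintro ⟨m, hm⟩
    exact ⟨(m - n).toNat, fun k hk => κ.ray_eq_iff.1 hm _ (by omega)⟩
  · rintro ⟨K, hK⟩
    refine ⟨n + K, κ.ray_eq_iff.2 fun k hk => ?_⟩
    have := hK (k - n).toNat (by omega)
    change κ.c y (n + ((k - n).toNat : ℤ)) = κ.c x (n + ((k - n).toNat : ℤ)) at this
    rwa [show n + ((k - n).toNat : ℤ) = k by omega] at this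

/-- A lift is determined by its initial vertex and its image, and there are finitely many vertices.
-/
theorem _root_.GraphHom.RightCovering.finite_preimage (hp : p.RightCovering) (T : Finset G.Ray) :
    {f : M.Ray | p.mapRay f ∈ T}.Finite := by
  refine Set.Finite.of_finite_image (f := fun f : M.Ray => (f.start, p.mapRay f))
    ((Set.finite_univ.prod T.finite_toSet).subset ?_) ?_
  · rintro _ ⟨f, hf, rfl⟩
    exact ⟨trivial, hf⟩
  · intro f _ g _ hfg
    exact hp.ray_eq (congrArg Prod.fst hfg) (congrArg Prod.snd hfg)

theorem isPullS (h : κ.Covers μ p π) (hp : p.RightCovering) :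
    π.IsPullS ((κ.ident.toAddMonoidHom.comp
      (DimGroup.map G.adjZ M.adjZ p.mat hp.mat_mul)).comp μ.ident.symm.toAddMonoidHom) := by
  classical
  intro E
  obtain ⟨j, -, hj⟩ := μ.exists_saturated_nat E 0
  let T : Finset M.Ray := (hp.finite_preimage (μ.rays (1 - j) E)).toFinset
  have hT : ∀ f, f ∈ T ↔ p.mapRay f ∈ μ.rays (1 - j) E := fun f => Set.Finite.mem_toFinset _
  -- The lifted rays are grouped by their tail class, which is the stable set of the points carrying
  -- them; the groups give the pieces of `π⁻¹(E)`.
  let Q : Finset (Quotient (tailSetoid M)) := T.image (Quotient.mk _)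
  let S : Q → Finset M.Ray := fun q => T.filter fun f => Quotient.mk (tailSetoid M) f = q.1
  have hS : ∀ q, (S q).Nonempty := by
    rintro ⟨q, hq⟩
    obtain ⟨f, hf, rfl⟩ := Finset.mem_image.1 hq
    exact ⟨f, Finset.mem_filter.2 ⟨hf, rfl⟩⟩
  let F : Q → X.COs := fun q => κ.ofRays (1 - j) (S q) (Finset.finite_toSet _) (hS q) (by
    obtain ⟨f, hf⟩ := hS q
    obtain ⟨x, rfl⟩ := κ.ray_surjective (1 - j) f
    refine ⟨x, fun y hy => (mem_stableSet_iff_tail κ (1 - j)).2 ?_⟩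
    rw [(Finset.mem_filter.1 hf).2, (Finset.mem_filter.1 hy).2])
  refine ⟨Fintype.card Q, fun k => F ((Fintype.equivFin Q).symm k), ?_, ?_, ?_⟩
  · ext x
    rw [Set.mem_preimage, Set.mem_iUnion]
    have hx : π.toFun x ∈ E.carrier ↔ κ.ray (1 - j) x ∈ T := by
      rw [hT, ← h.ray, Coding.mem_rays]
      constructor
      · intro hx
        exact ⟨_, hx, rfl⟩
      · rintro ⟨y, hy, hyx⟩
        exact hj y hy _ hyx.symm
    rw [hx]
    constructor
    · intro hxT
      refine ⟨Fintype.equivFin Q ⟨_, Finset.mem_image_of_mem _ hxT⟩, ?_⟩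
      beta_reduce
      rw [Equiv.symm_apply_apply]
      exact Finset.mem_coe.2 (Finset.mem_filter.2 ⟨hxT, rfl⟩)
    · rintro ⟨k, hk⟩
      exact (Finset.mem_filter.1 (Finset.mem_coe.1 hk)).1
  · intro k l hkl x hx y hy hxy
    refine hkl ((Fintype.equivFin Q).symm.injective (Subtype.ext ?_))
    rw [← (Finset.mem_filter.1 (Finset.mem_coe.1 hx)).2,
      ← (Finset.mem_filter.1 (Finset.mem_coe.1 hy)).2]
    exact ((mem_stableSet_iff_tail κ (1 - j)).1 hxy).symm
  · have hF : ∀ q, X.clsS (F q) = ∑ f ∈ S q, κ.rcls (1 - j) f := fun q =>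
      κ.clsS_eq_sum (1 - j) (S q) (hS q) (F q) rfl
    rw [Equiv.sum_comp (Fintype.equivFin Q).symm fun q => X.clsS (F q),
      Finset.sum_congr rfl fun q _ => hF q,
      Finset.sum_coe_sort Q fun q => ∑ f ∈ T.filter (fun f => Quotient.mk (tailSetoid M) f = q),
        κ.rcls (1 - j) f,
      Finset.sum_fiberwise_of_maps_to fun f hf => Finset.mem_image_of_mem _ hf, Coding.sum_rcls]
    change κ.ident (DimGroup.map _ _ _ hp.mat_mul (μ.ident.symm (Y.clsS E))) = _
    rw [μ.ident_symm_clsS hj, DimGroup.map_mk, κ.ident_mk]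
    congr 1
    funext m
    rw [p.mat_mulVec, countVec, countVec, Nat.cast_inj]
    symm
    -- Each ray starting at `p.onV m` has exactly one lift starting at `m`.
    refine Finset.card_bij (fun f _ => p.mapRay f) ?_ ?_ ?_
    · intro f hf
      obtain ⟨hf, hm⟩ := Finset.mem_filter.1 hf
      exact Finset.mem_filter.2 ⟨(hT f).1 hf, by rw [p.mapRay_start, hm]⟩
    · intro f hf g hg hfg
      exact hp.ray_eq ((Finset.mem_filter.1 hf).2.trans (Finset.mem_filter.1 hg).2.symm) hfg
    · intro r hr
      obtain ⟨hr, hm⟩ := Finset.mem_filter.1 hr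
      obtain ⟨f, hf, rfl⟩ := hp.exists_ray r m hm
      exact ⟨f, Finset.mem_filter.2 ⟨(hT f).2 hr, hf⟩, rfl⟩

end Coding.Covers

/-- A pair of coverings `p : M → G` and `q : M → H` induces the map `[v, j] ↦ [Q P v, j]` of
dimension groups. -/
theorem exists_induced {X Y Z : SmaleSpace.{u}} {M G H : FinGraph.{u}} (κ : Coding X M)
    (μ : Coding Y G) (ν : Coding Z H) {p : GraphHom M G} {q : GraphHom M H} {πu : SmaleMap X Y}
    {πs : SmaleMap X Z} (hu : κ.Covers μ p πu) (hs : κ.Covers ν q πs) (hp : p.RightCovering)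
    (hq : q.LeftCovering) (A : Matrix G.V G.V ℤ) (hA : A = G.adjZ) (B : Matrix H.V H.V ℤ)
    (hB : B = H.adjZ) (F : Matrix H.V G.V ℤ) (hF : F = q.mat.transpose * p.mat)
    (h : F * A = B * F) :
    ∃ (θG : DimGroup A ≃+ Y.Ds) (θH : DimGroup B ≃+ Z.Ds) (πus : Y.Ds →+ X.Ds)
      (πss : X.Ds →+ Z.Ds),
      (∀ (x : Y) (j : ℕ), θG (DimGroup.mk A (Pi.single (G.i (μ.c x (1 - (j : ℤ)))) 1) j) =
        Y.clsS (μ.cyl (1 - j) (μ.ray (1 - j) x))) ∧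
      (∀ (x : Z) (j : ℕ), θH (DimGroup.mk B (Pi.single (H.i (ν.c x (1 - (j : ℤ)))) 1) j) =
        Z.clsS (ν.cyl (1 - j) (ν.ray (1 - j) x))) ∧
      πu.IsPullS πus ∧ πs.IsPushS πss ∧
      ∀ a, πss (πus (θG a)) = θH (DimGroup.map A B F h a) := by
  -- The matrices enter as variables with equations so that the transposes, equal to the adjacency
  -- matrices of the reversed graphs by `adjZ_rev`, can be inserted in the unstable case.
  subst hA hB hF
  refine ⟨μ.ident, ν.ident, _, _, μ.ident_single, ν.ident_single, hu.isPullS hp, hs.isPushS hq,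
    fun a => ?_⟩
  rw [← DimGroup.map_map _ M.adjZ _ _ _ hp.mat_mul hq.transpose_mat_mul]
  change ν.ident (DimGroup.map _ _ _ hq.transpose_mat_mul (κ.ident.symm (κ.ident
    (DimGroup.map _ _ _ hp.mat_mul (μ.ident.symm (μ.ident a)))))) = _
  rw [AddEquiv.symm_apply_apply, AddEquiv.symm_apply_apply]

/-! ### Shifts of finite type and the construction of the middle graph -/

namespace FinGraph

/-- The map of shifts of finite type given by a graph homomorphism. -/
noncomputable def _root_.GraphHom.shiftMap {M G : FinGraph.{u}} (p : GraphHom M G) :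
    SmaleMap M.shift G.shift where
  toFun x := ⟨fun k => p.onE (x.edge k), fun k => by rw [p.t_onE, p.i_onE, x.chain]⟩
  continuous := Path.continuous_iff.2 fun k => by
    let _ : TopologicalSpace G.E := ⊥
    let _ : TopologicalSpace M.E := ⊥
    have : DiscreteTopology M.E := ⟨rfl⟩
    exact (continuous_of_discreteTopology (f := p.onE)).comp (Path.continuous_coord (G := M) k)
  comm _ := rfl

theorem _root_.GraphHom.covers {M G : FinGraph.{u}} (p : GraphHom M G) :
    (Coding.ofShift M).Covers (Coding.ofShift G) p p.shiftMap := fun _ _ => rfl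

theorem _root_.GraphHom.covers_inv {M G : FinGraph.{u}} (p : GraphHom M G) :
    (Coding.ofShiftInv M).Covers (Coding.ofShiftInv G) p.rev p.shiftMap.inv := fun _ _ => rfl

/-- The image of `p.onV` is closed under following edges, and it is nonempty. -/
theorem _root_.GraphHom.RightCovering.surjective_onV {M G : FinGraph.{u}} {p : GraphHom M G}
    (hp : p.RightCovering) (hG : G.Irreducible) (m₀ : M.V) : Function.Surjective p.onV := by
  intro v
  induction hG (p.onV m₀) v with
  | refl => exact ⟨m₀, rfl⟩
  | tail _ h ih =>
    obtain ⟨g, hg, rfl⟩ := h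
    obtain ⟨m, rfl⟩ := ih
    obtain ⟨e, ⟨-, rfl⟩, -⟩ := hp m g hg
    exact ⟨_, (p.t_onE e).symm⟩

theorem Irreducible.rev {G : FinGraph.{u}} (hG : G.Irreducible) : G.rev.Irreducible := by
  intro v w
  refine Relation.ReflTransGen.mono ?_ _ _ (Relation.reflTransGen_swap.2 (hG w v))
  rintro a b ⟨e, h1, h2⟩
  exact ⟨e, h2, h1⟩

variable {G H : FinGraph.{u}} (F : H.V → G.V → ℕ)

/-- The arrows of the bipartite graph with `F w v` arrows from `w` to `v`. -/
abbrev Arrow : Type u := Σ w : H.V, Σ v : G.V, Fin (F w v)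

/-- The paths consisting of an arrow and an edge of `G`. -/
abbrev OutPair : Type u := {a : Arrow F × G.E // a.1.2.1 = G.i a.2}

/-- The paths consisting of an edge of `H` and an arrow. -/
abbrev InPair : Type u := {b : H.E × Arrow F // H.t b.1 = b.2.1}

theorem card_outPair (w : H.V) (v : G.V) :
    Nat.card {a : OutPair F // (a.1.1.1, G.t a.1.2) = (w, v)} = (Matrix.of F * G.adj) w v := by
  have e : {a : OutPair F // (a.1.1.1, G.t a.1.2) = (w, v)} ≃
      Σ v' : G.V, Fin (F w v') × {g : G.E // G.i g = v' ∧ G.t g = v} :=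
    { toFun := fun a => ⟨a.1.1.1.2.1,
        Fin.cast (congrArg (fun w' => F w' _) (Prod.mk.inj a.2).1) a.1.1.1.2.2,
        ⟨a.1.1.2, a.1.2.symm, (Prod.mk.inj a.2).2⟩⟩
      invFun := fun a => ⟨⟨(⟨w, a.1, a.2.1⟩, a.2.2.1), a.2.2.2.1.symm⟩, Prod.ext rfl a.2.2.2.2⟩
      left_inv := by
        rintro ⟨⟨⟨⟨w', v', n⟩, g⟩, h1⟩, h2⟩
        obtain ⟨rfl, rfl⟩ := Prod.mk.inj h2
        rfl
      right_inv := by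
        rintro ⟨v', n, g, h1, h2⟩
        rfl }
  rw [Nat.card_congr e, Nat.card_sigma, Matrix.mul_apply]
  refine Finset.sum_congr rfl fun v' _ => ?_
  rw [Nat.card_prod, Nat.card_fin]
  rfl

theorem card_inPair (w : H.V) (v : G.V) :
    Nat.card {b : InPair F // (H.i b.1.1, b.1.2.2.1) = (w, v)} = (H.adj * Matrix.of F) w v := by
  have e : {b : InPair F // (H.i b.1.1, b.1.2.2.1) = (w, v)} ≃
      Σ w' : H.V, {h : H.E // H.i h = w ∧ H.t h = w'} × Fin (F w' v) :=
    { toFun := fun b => ⟨b.1.1.2.1, ⟨b.1.1.1, (Prod.mk.inj b.2).1, b.1.2⟩,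
        Fin.cast (congrArg (F _) (Prod.mk.inj b.2).2) b.1.1.2.2.2⟩
      invFun := fun b => ⟨⟨(b.2.1.1, ⟨b.1, v, b.2.2⟩), b.2.1.2.2⟩, Prod.ext b.2.1.2.1 rfl⟩
      left_inv := by
        rintro ⟨⟨⟨h, ⟨w', v', n⟩⟩, h1⟩, h2⟩
        obtain ⟨rfl, rfl⟩ := Prod.mk.inj h2
        rfl
      right_inv := by
        rintro ⟨w', ⟨h, h1, h2⟩, n⟩
        rfl }
  rw [Nat.card_congr e, Nat.card_sigma, Matrix.mul_apply]
  refine Finset.sum_congr rfl fun v' _ => ?_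
  rw [Nat.card_prod, Nat.card_fin]
  rfl

/-- Entrywise, the matrix equation says that the two kinds of paths with given ends are
equinumerous; bijections of the fibres glue to one that keeps the ends. -/
theorem exists_pairEquiv (hFA : Matrix.of F * G.adj = H.adj * Matrix.of F) :
    ∃ Φ : OutPair F ≃ InPair F, ∀ a, H.i (Φ a).1.1 = a.1.1.1 ∧ (Φ a).1.2.2.1 = G.t a.1.2 := by
  let f : OutPair F → H.V × G.V := fun a => (a.1.1.1, G.t a.1.2)
  let g : InPair F → H.V × G.V := fun b => (H.i b.1.1, b.1.2.2.1)
  have hcard : ∀ c : H.V × G.V, Nonempty ({a // f a = c} ≃ {b // g b = c}) := by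
    rintro ⟨w, v⟩
    refine Finite.card_eq.1 ?_
    exact (card_outPair F w v).trans ((congrFun₂ hFA w v).trans (card_inPair F w v).symm)
  refine ⟨Equiv.ofFiberEquiv fun c => (hcard c).some, fun a => ?_⟩
  exact Prod.mk.inj (Equiv.ofFiberEquiv_map (f := f) (g := g) (fun c => (hcard c).some) a)

variable {F}

/-- The graph whose vertices are the arrows of `F`; its edges are both the pairs of an arrow and
an edge of `G` and the pairs of an edge of `H` and an arrow. -/
abbrev coverGraph (Φ : OutPair F ≃ InPair F) : FinGraph.{u} where
  V := Arrow F
  E := OutPair F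
  i a := a.1.1
  t a := (Φ a).1.2
  no_sources x := by
    obtain ⟨h, hh⟩ := H.no_sources x.1
    exact ⟨Φ.symm ⟨(h, x), hh⟩, by rw [Equiv.apply_symm_apply]⟩
  no_sinks x := by
    obtain ⟨e, he⟩ := G.no_sinks x.2.1
    exact ⟨⟨(x, e), he.symm⟩, rfl⟩

/-- There is a graph covering `G` on the right and `H` on the left with vertex matrix `F`. -/
theorem exists_covering (hFA : Matrix.of F * G.adj = H.adj * Matrix.of F) :
    ∃ (M : FinGraph.{u}) (p : GraphHom M G) (q : GraphHom M H), p.RightCovering ∧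
      q.LeftCovering ∧ (F ≠ 0 → Nonempty M.V) ∧
      (Matrix.of F).map (Nat.cast : ℕ → ℤ) = q.mat.transpose * p.mat := by
  obtain ⟨Φ, hΦ⟩ := exists_pairEquiv F hFA
  let p : GraphHom (coverGraph Φ) G :=
    { onV := fun x => x.2.1
      onE := fun a => a.1.2
      i_onE := fun a => a.2.symm
      t_onE := fun a => (hΦ a).2.symm }
  let q : GraphHom (coverGraph Φ) H :=
    { onV := fun x => x.1
      onE := fun a => (Φ a).1.1
      i_onE := fun a => (hΦ a).1
      t_onE := fun a => (Φ a).2 }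
  refine ⟨coverGraph Φ, p, q, ?_, ?_, ?_, ?_⟩
  · intro m e he
    refine ⟨⟨(m, e), he.symm⟩, ⟨rfl, rfl⟩, ?_⟩
    rintro a ⟨h1, h2⟩
    exact Subtype.ext (Prod.ext h1 h2)
  · intro m h hh
    refine ⟨Φ.symm ⟨(h, m), hh⟩, ?_, ?_⟩
    · change (Φ _).1.2 = m ∧ (Φ _).1.1 = h
      rw [Equiv.apply_symm_apply]
      exact ⟨rfl, rfl⟩
    · rintro a ⟨h1, h2⟩
      rw [Equiv.eq_symm_apply]
      exact Subtype.ext (Prod.ext h2 h1)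
  · intro hF
    by_contra hM
    refine hF (funext₂ fun w v => ?_)
    by_contra h0
    exact hM ⟨⟨w, v, ⟨0, Nat.pos_of_ne_zero h0⟩⟩⟩
  · ext w v
    rw [Matrix.mul_apply]
    -- The right side counts the arrows from `w` to `v`.
    change (F w v : ℤ) = ∑ x : Arrow F, (if x.1 = w then (1 : ℤ) else 0) *
      (if x.2.1 = v then (1 : ℤ) else 0)
    rw [Fintype.sum_sigma, Finset.sum_eq_single w, Fintype.sum_sigma, Finset.sum_eq_single v]
    · simp
    · intro v' _ hv
      simp [hv]
    · simp
    · intro w' _ hw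
      simp [hw]
    · simp

end FinGraph

/-! ### The correspondence and its action on dimension groups -/

theorem mainTheorem2 (G H : FinGraph.{u}) (hG : G.Irreducible) (hH : H.Irreducible)
    (F : Matrix H.V G.V ℕ) (hF : F ≠ 0) (hFA : F * G.adj = H.adj * F) :
    ∃ (M : FinGraph.{u}) (C : Correspondence G.shift M.shift H.shift),
      Function.Surjective C.πu.toFun ∧ Function.Surjective C.πs.toFun ∧
      (∃ (θG : G.DimS ≃+ G.shift.Ds) (θH : H.DimS ≃+ H.shift.Ds)
          (πus : G.shift.Ds →+ M.shift.Ds) (πss : M.shift.Ds →+ H.shift.Ds),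
        G.IsIdentS θG ∧ H.IsIdentS θH ∧ C.πu.IsPullS πus ∧ C.πs.IsPushS πss ∧
        ∀ a : G.DimS, πss (πus (θG a)) = θH (FinGraph.lowerStar F hFA a)) ∧
      (∃ (θG : G.DimU ≃+ G.shift.Du) (θH : H.DimU ≃+ H.shift.Du)
          (πsu : H.shift.Du →+ M.shift.Du) (πuu : M.shift.Du →+ G.shift.Du),
        G.IsIdentU θG ∧ H.IsIdentU θH ∧ C.πs.IsPullU πsu ∧ C.πu.IsPushU πuu ∧
        ∀ b : H.DimU, πuu (πsu (θH b)) = θG (FinGraph.upperStar F hFA b)) := by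
  obtain ⟨M, p, q, hp, hq, hM, hmat⟩ := FinGraph.exists_covering (F := F) hFA
  obtain ⟨m₀⟩ := hM hF
  replace hmat : F.map (Nat.cast : ℕ → ℤ) = q.mat.transpose * p.mat := hmat
  have hpr : p.rev.LeftCovering := hp
  have hqr : q.rev.RightCovering := hq
  have hidS : ∀ {G : FinGraph.{u}} (θ : G.DimS ≃+ G.shift.Ds),
      (∀ (x : G.Path) (j : ℕ), θ (DimGroup.mk G.adjZ (Pi.single (G.i (x (1 - (j : ℤ)))) 1) j) =
        G.shift.clsS ((Coding.ofShift G).cyl (1 - j) ((Coding.ofShift G).ray (1 - j) x))) →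
      G.IsIdentS θ := fun {G} θ h x j =>
    ⟨(Coding.ofShift G).cyl (1 - j) ((Coding.ofShift G).ray (1 - j) x),
      Set.ext fun y => (Coding.ofShift G).ray_eq_iff.trans
        ⟨fun hy k hk => hy k hk, fun hy k hk => hy k hk⟩, h x j⟩
  have hidU : ∀ {G : FinGraph.{u}} (θ : G.DimU ≃+ G.shift.Du),
      (∀ (x : G.Path) (j : ℕ), θ (DimGroup.mk G.adjZ.transpose
        (Pi.single (G.rev.i ((Coding.ofShiftInv G).c x (1 - (j : ℤ)))) 1) j) =
        G.shift.inv.clsS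
          ((Coding.ofShiftInv G).cyl (1 - j) ((Coding.ofShiftInv G).ray (1 - j) x))) →
      G.IsIdentU θ := by
    intro G θ h x j
    refine ⟨(Coding.ofShiftInv G).cyl (1 - j) ((Coding.ofShiftInv G).ray (1 - j) x),
      Set.ext fun y => (Coding.ofShiftInv G).ray_eq_iff.trans ⟨fun hy k hk => ?_,
      fun hy k hk => hy (1 - k) (by omega)⟩, ?_⟩
    · have := hy (1 - k) (by omega)
      change y (1 - (1 - k)) = x (1 - (1 - k)) at this
      rwa [sub_sub_cancel] at this
    · refine Eq.trans ?_ (h x j)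
      change _ = θ (DimGroup.mk G.adjZ.transpose (Pi.single (G.t (x (1 - (1 - (j : ℤ))))) 1) j)
      rw [sub_sub_cancel]
  refine ⟨M, ⟨p.shiftMap, q.shiftMap, p.covers_inv.sBijective hpr, q.covers.sBijective hq⟩,
    p.covers.surjective hp (hp.surjective_onV hG m₀),
    q.covers_inv.surjective hqr (hqr.surjective_onV hH.rev m₀), ?_, ?_⟩
  · obtain ⟨θG, θH, πus, πss, h1, h2, h3, h4, h5⟩ := exists_induced (Coding.ofShift M)
      (Coding.ofShift G) (Coding.ofShift H) p.covers q.covers hp hq G.adjZ rfl H.adjZ rfl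
      (F.map (Nat.cast : ℕ → ℤ)) hmat (FinGraph.adjZ_intertwine F hFA)
    exact ⟨θG, θH, πus, πss, hidS θG h1, hidS θH h2, h3, h4, h5⟩
  · obtain ⟨θH, θG, πsu, πuu, h1, h2, h3, h4, h5⟩ := exists_induced (Coding.ofShiftInv M)
      (Coding.ofShiftInv H) (Coding.ofShiftInv G) q.covers_inv p.covers_inv hqr hpr
      H.adjZ.transpose H.adjZ_rev.symm G.adjZ.transpose G.adjZ_rev.symm
      (F.map (Nat.cast : ℕ → ℤ)).transpose
      (by rw [hmat, Matrix.transpose_mul, Matrix.transpose_transpose]; rfl)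
      (by rw [← Matrix.transpose_mul, ← Matrix.transpose_mul, FinGraph.adjZ_intertwine F hFA])
    exact ⟨θG, θH, πsu, πuu, hidU θG h2, hidU θH h1, h3, h4, h5⟩
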